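/- All algebras are finite-dimensional over a field $K$, and $D=\operatorname{Hom}_K(-,K)$. For a finite-dimensional (right or left) module $M$ over such an algebra, with minimal injective resolution $0\to M\to I_0\to I_1\to\cdots$, the dominant dimension $\operatorname{domdim}(M)\in\{0,1,2,\dots,\infty\}$ is the supremum of all $n\ge 0$ such that $I_0,\dots,I_{n-1}$ are projective, and $\operatorname{codomdim}(M):=\operatorname{domdim}(D(M))$. The module $M$ over an algebra $A$ is Gorenstein projective if $\operatorname{Ext}^i(M,A)=0=\operatorname{Ext}^i(\operatorname{Tr}M,A)$ for all $i\ge 1$, where $\operatorname{Tr}M$ is the cokernel of $\operatorname{Hom}_A(P_0,A)\to\operatorname{Hom}_A(P_1,A)$ for a minimal projective presentation $P_1\to P_0\to M\to 0$; it is Gorenstein injective if $D(M)$ is Gorenstein projective, and Gorenstein projective-injective if it is both. An algebra $A$ is gendo-symmetric if $\operatorname{domdim}(A_A)\ge 2$ and $D(Ae)\cong eA$ as $(eAe,A)$-bimodules, where $e\in A$ is an idempotent such that $eA$ is a minimal faithful projective-injective right $A$-module (minimal faithful: faithful and a direct summand of every finitely generated faithful module). It has Gorenstein dimension $g\in\mathbb{N}$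 if the injective dimensions of $A$ as a right module and as a left module over itself are both equal to $g$. It is selfinjective if $A_A$ is injective. **Proposition.** Let $A$ be a gendo-symmetric, nonselfinjective, finite-dimensional $K$-algebra of Gorenstein dimension $g$. For every finite-dimensional right $A$-module $M$ the following are equivalent: 1. $M$ is Gorenstein projective-injective; 2. $\operatorname{domdim}(M)+\operatorname{codomdim}(M)\ge 2g$; 3. $\operatorname{domdim}(M)\ge 2g$; 4. $\operatorname{codomdim}(M)\ge 2g$. -/

import Mathlib

universe u

namespace GendoSymm

open CategoryTheory MulOpposite

section Generic

variable (R : Type u) [Ring R] (M : Type u) [AddCommGroup M] [Module R M]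

/-- A submodule is essential if it meets every nonzero submodule nontrivially. -/
def IsEssential {R : Type u} [Ring R] {M : Type u} [AddCommGroup M] [Module R M]
    (N : Submodule R M) : Prop :=
  ∀ L : Submodule R M, N ⊓ L = ⊥ → L = ⊥

/-- A submodule `N` is superfluous if `N + L = M` forces `L = M`. -/
def IsSuperfluous {R : Type u} [Ring R] {M : Type u} [AddCommGroup M] [Module R M]
    (N : Submodule R M) : Prop :=
  ∀ L : Submodule R M, N ⊔ L = ⊤ → L = ⊤

/-- A minimal injective (co)resolution `0 → M → I 0 → I 1 → ⋯`: an exact sequence of injective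
modules in which `M ↪ I 0` and each `im (I n → I (n+1)) ↪ I (n+1)` is essential. -/
structure MinInjResolution where
  I : ℕ → ModuleCat.{u} R
  injective : ∀ n, Module.Injective R (I n)
  ι : M →ₗ[R] I 0
  d : ∀ n, I n →ₗ[R] I (n + 1)
  ι_injective : Function.Injective ι
  exact_zero : Function.Exact ι (d 0)
  exact_succ : ∀ n, Function.Exact (d n) (d (n + 1))
  essential_zero : IsEssential (LinearMap.range ι)
  essential_succ : ∀ n, IsEssential (LinearMap.range (d n))

/-- The dominant dimension of `M`: the supremum of all `n` such that the first `n` terms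
`I 0, …, I (n-1)` of a minimal injective resolution of `M` are projective (it is `0` if `I 0` is
not projective). Minimal injective resolutions are unique up to isomorphism. -/
noncomputable def domdim : ℕ∞ :=
  ⨆ (n : ℕ) (_ : ∃ E : MinInjResolution R M, ∀ i < n, Module.Projective R (E.I i)), (n : ℕ∞)

/-- A minimal projective presentation `P₁ → P₀ → M → 0` by finitely generated projectives:
`P₀ → M` and `P₁ → ker (P₀ → M)` are projective covers. -/
structure MinProjPresentation where
  P₀ : ModuleCat.{u} R
  P₁ : ModuleCat.{u} R
  finite₀ : Module.Finite R P₀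
  finite₁ : Module.Finite R P₁
  projective₀ : Module.Projective R P₀
  projective₁ : Module.Projective R P₁
  π : P₀ →ₗ[R] M
  d : P₁ →ₗ[R] P₀
  π_surjective : Function.Surjective π
  exact : Function.Exact d π
  superfluous₀ : IsSuperfluous (LinearMap.ker π)
  superfluous₁ : IsSuperfluous (LinearMap.ker d)

/-- `Ext^i_R(M, N) = 0` for all `i ≥ 1`. -/
def ExtVanishes (N : Type u) [AddCommGroup N] [Module R N] : Prop :=
  ∀ i : ℕ, 1 ≤ i → Subsingleton (Abelian.Ext (ModuleCat.of R M) (ModuleCat.of R N) i)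

variable (S : Type u) [Ring S] (U : Type u) [AddCommGroup U] [Module R U] [Module S U]
  [SMulCommClass R S U]

/-- The transpose: the cokernel of `Hom_R(P₀, U) → Hom_R(P₁, U)` as an `S`-module, where
`U` is an `R`-`S`-bimodule. It is used for `U = A` the regular bimodule, with `R` and `S` acting
on the two sides. -/
abbrev Transpose {R : Type u} [Ring R] {M : Type u} [AddCommGroup M] [Module R M]
    (S : Type u) [Ring S] (U : Type u) [AddCommGroup U] [Module R U] [Module S U]
    [SMulCommClass R S U] (p : MinProjPresentation R M) : Type u :=
  (p.P₁ →ₗ[R] U) ⧸ LinearMap.range (LinearMap.lcomp S U p.d)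

/-- `Ext^i(M, U) = 0 = Ext^i(Tr M, U)` for all `i ≥ 1`, for `U` the regular bimodule. -/
def IsGProj : Prop :=
  ExtVanishes R M U ∧
    ∃ p : MinProjPresentation R M, ExtVanishes S (Transpose S U p) U

/-- A minimal faithful module: a faithful module that is a direct summand of every
finitely generated faithful module. -/
def IsMinimalFaithful : Prop :=
  FaithfulSMul R M ∧
    ∀ (N : Type u) [AddCommGroup N] [Module R N], Module.Finite R N → FaithfulSMul R N →
      ∃ (i : M →ₗ[R] N) (p : N →ₗ[R] M), p ∘ₗ i = LinearMap.id

end Generic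

section Dual

variable (K : Type u) [Field K] (A : Type u) [Ring A] [Algebra K A]
  (M : Type u) [AddCommGroup M] [Module K M] [Module Aᵐᵒᵖ M] [IsScalarTower K Aᵐᵒᵖ M]

/-- The standard duality `D(M) = Hom_K(M, K)`. -/
def D (K : Type u) [Field K] (M : Type u) [AddCommGroup M] [Module K M] : Type u := M →ₗ[K] K

/-- The linear form underlying an element of `D(M)`. -/
def D.toLin {K : Type u} [Field K] {M : Type u} [AddCommGroup M] [Module K M] (f : D K M) :
    M →ₗ[K] K := f

noncomputable instance (K : Type u) [Field K] (M : Type u) [AddCommGroup M] [Module K M] :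
    AddCommGroup (D K M) :=
  inferInstanceAs (AddCommGroup (M →ₗ[K] K))

/-- For a right `A`-module `M`, `D(M)` is a left `A`-module by `(a • f) m = f (m a)`. -/
noncomputable instance : Module A (D K M) where
  smul a f := (LinearMap.comp f.toLin (Algebra.lsmul K K M (op a)) : M →ₗ[K] K)
  one_smul f := LinearMap.ext fun m => congrArg f.toLin (one_smul Aᵐᵒᵖ m)
  mul_smul a b f := LinearMap.ext fun m => congrArg f.toLin (mul_smul (op b) (op a) m)
  smul_zero _ := rfl
  smul_add _ _ _ := rfl
  add_smul a b f := LinearMap.ext fun m =>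
    (congrArg f.toLin (add_smul (op a) (op b) m)).trans (map_add f.toLin _ _)
  zero_smul f := LinearMap.ext fun m =>
    (congrArg f.toLin (zero_smul Aᵐᵒᵖ m)).trans (map_zero f.toLin)

theorem D.smul_apply (a : A) (f : D K M) (m : M) :
    (a • f).toLin m = f.toLin (op a • m) := rfl

/-- The codominant dimension of a right `A`-module: the dominant dimension of the left
`A`-module `D(M)`. -/
noncomputable def codomdim : ℕ∞ := domdim A (D K M)

/-- `M` is Gorenstein projective and Gorenstein injective, for a right `A`-module `M`. -/
def IsGorensteinProjectiveInjective : Prop :=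
  IsGProj Aᵐᵒᵖ M A A ∧ IsGProj A (D K M) Aᵐᵒᵖ A

end Dual

section Algebras

variable (K : Type u) [Field K] (A : Type u) [Ring A] [Algebra K A]

/-- The right ideal `eA`, as a right `A`-module. -/
def rightIdeal (e : A) : Submodule Aᵐᵒᵖ A where
  carrier := {y | ∃ a, y = e * a}
  add_mem' := by
    rintro _ _ ⟨a, rfl⟩ ⟨b, rfl⟩
    exact ⟨a + b, (mul_add e a b).symm⟩
  zero_mem' := ⟨0, (mul_zero e).symm⟩
  smul_mem' := by
    rintro c _ ⟨a, rfl⟩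
    exact ⟨a * c.unop, by simp [mul_assoc]⟩

/-- The left ideal `Ae`, as a left `A`-module. -/
def leftIdeal (e : A) : Submodule A A where
  carrier := {z | ∃ a, z = a * e}
  add_mem' := by
    rintro _ _ ⟨a, rfl⟩ ⟨b, rfl⟩
    exact ⟨a + b, (add_mul a b e).symm⟩
  zero_mem' := ⟨0, (zero_mul e).symm⟩
  smul_mem' := by
    rintro c _ ⟨a, rfl⟩
    exact ⟨c * a, by simp [mul_assoc]⟩

/-- For `x = e b e ∈ eAe`, `y ∈ eA`, `a ∈ A`: the element `x y a` of `eA`. -/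
def rightIdeal.act {A : Type u} [Ring A] {e : A} (b : A) (y : rightIdeal A e) (a : A) :
    rightIdeal A e :=
  ⟨(e * b * e) * y * a, ⟨b * e * y * a, by simp [mul_assoc]⟩⟩

/-- For `x = e b e ∈ eAe`, `z ∈ Ae`, `a ∈ A`: the element `a z x` of `Ae`. -/
def leftIdeal.act {A : Type u} [Ring A] {e : A} (a : A) (z : leftIdeal A e) (b : A) :
    leftIdeal A e :=
  ⟨a * z * (e * b * e), ⟨a * z * (e * b), by simp [mul_assoc]⟩⟩

/-- `eA ≅ D(Ae)` as `(eAe, A)`-bimodules, where `D(Ae)` carries the bimodule structure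
`(x f a)(z) = f (a z x)`. -/
def HasBimoduleIso (e : A) : Prop :=
  ∃ φ : rightIdeal A e ≃ₗ[K] Module.Dual K (leftIdeal A e),
    ∀ (b a : A) (y : rightIdeal A e) (z : leftIdeal A e),
      φ (rightIdeal.act b y a) z = φ y (leftIdeal.act a z b)

/-- Gendo-symmetric algebras: the dominant dimension of `A_A` is at least two and, for an
idempotent `e` such that `eA` is a minimal faithful projective-injective right module,
`D(Ae) ≅ eA` as `(eAe, A)`-bimodules. -/
structure IsGendoSymmetric : Prop where
  two_le_domdim : 2 ≤ domdim Aᵐᵒᵖ A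
  exists_idempotent : ∃ e : A, IsIdempotentElem e ∧
    IsMinimalFaithful Aᵐᵒᵖ (rightIdeal A e) ∧
    Module.Projective Aᵐᵒᵖ (rightIdeal A e) ∧
    Module.Injective Aᵐᵒᵖ (rightIdeal A e) ∧
    HasBimoduleIso K A e

/-- `A` is Gorenstein of Gorenstein dimension `g`: the right and the left injective dimension
of the regular module both equal `g`. -/
structure IsGorensteinOfDim (g : ℕ) : Prop where
  right : injectiveDimension (ModuleCat.of Aᵐᵒᵖ A) = g
  left : injectiveDimension (ModuleCat.of A A) = g

/-- `A` is selfinjective: the regular right module is injective. -/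
def IsSelfinjective : Prop := Module.Injective Aᵐᵒᵖ A

end Algebras

end GendoSymm

/-!
Let `e` be an idempotent such that `eA` is minimal faithful projective-injective. Over a
gendo-symmetric algebra, `domdim M ≥ n` means that `Ext^i(X, M) = 0` for all `i < n` and all modules
`X` killed by `e`: then `M` has depth `n`. The symmetrising form on `eAe` makes the left ideal `Ae`
injective, so a module of depth `n + 1` embeds into a power of `Ae` with cokernel of depth `n`.
Walking along such cosyzygies, depth `k` and injective dimension `g` of `A` give `Ext^j(M, A) = 0`
for `j + k > g`.

Duality turns `Ext^j(M, A)` into `Ext^j(DA, DM)`. Because `A` has the double centraliser property,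
there is a map `DA → A` whose kernel and cokernel are killed by `e`, and vanishing of `Ext(DA, DM)`
propagates depth: a module of depth two with `Ext^i(DA, N) = 0` for all `i ≥ 1` has infinite depth.
Hence if `M` and `DM` both have depth at least `g`, all their depths are infinite. If the depths
only add up to `2g`, passing to a cosyzygy moves one unit of depth from `M` to `DM` until both are
`g`. Finally, modules of infinite depth on both sides satisfy the `Ext` conditions of Gorenstein
projectivity, and conversely Gorenstein projective modules are reflexive, hence of depth two.
-/

namespace GendoSymm

open CategoryTheory MulOpposite

/-! ### Vanishing of `Ext` along short exact sequences -/

section ExtSequences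

/-- The vanishing of the single group `Ext^n_R(M, N)`. -/
abbrev ExtVanishesAt (R : Type u) [Ring R] (M N : Type u) [AddCommGroup M] [Module R M]
    [AddCommGroup N] [Module R N] (n : ℕ) : Prop :=
  Subsingleton (Abelian.Ext (ModuleCat.of R M) (ModuleCat.of R N) n)

variable {R : Type u} [Ring R] {X M I N : Type u} [AddCommGroup X] [Module R X]
  [AddCommGroup M] [Module R M] [AddCommGroup I] [Module R I] [AddCommGroup N] [Module R N]

theorem extVanishes_iff_forall_succ :
    ExtVanishes R M N ↔ ∀ n, ExtVanishesAt R M N (n + 1) :=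
  ⟨fun h n => h (n + 1) n.succ_pos, fun h n hn => Nat.sub_add_cancel hn ▸ h (n - 1)⟩

theorem extVanishesAt_zero_iff : ExtVanishesAt R M N 0 ↔ ∀ f : M →ₗ[R] N, f = 0 := by
  constructor
  · intro h f
    have : Subsingleton (ModuleCat.of R M ⟶ ModuleCat.of R N) :=
      Abelian.Ext.homEquiv₀.symm.subsingleton
    exact congrArg ModuleCat.Hom.hom (Subsingleton.elim (ModuleCat.ofHom f) 0)
  · intro h
    have : Subsingleton (ModuleCat.of R M ⟶ ModuleCat.of R N) :=
      ⟨fun a b => ModuleCat.hom_ext ((h a.hom).trans (h b.hom).symm)⟩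
    exact Abelian.Ext.homEquiv₀.subsingleton

theorem extVanishesAt_succ_of_projective [Module.Projective R M] (n : ℕ) :
    ExtVanishesAt R M N (n + 1) := by
  have : Projective (ModuleCat.of R M) := (IsProjective.iff_projective M).1 inferInstance
  exact Abelian.Ext.subsingleton_of_projective _ _ n

theorem extVanishesAt_succ_of_injective (hN : Module.Injective R N) (n : ℕ) :
    ExtVanishesAt R M N (n + 1) := by
  have : Injective (ModuleCat.of R N) := Module.injective_object_of_injective_module R N
  exact Abelian.Ext.subsingleton_of_injective _ _ n

theorem extVanishesAt_of_hasInjectiveDimensionLE {g n : ℕ}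
    (h : HasInjectiveDimensionLE (ModuleCat.of R N) g) (hn : g < n) : ExtVanishesAt R M N n :=
  h.subsingleton (ModuleCat.of R N) (g + 1) n hn (ModuleCat.of R M)

theorem ExtVanishesAt.of_linearEquiv {M' N' : Type u} [AddCommGroup M'] [Module R M']
    [AddCommGroup N'] [Module R N'] {n : ℕ} (h : ExtVanishesAt R M N n) (φ : M ≃ₗ[R] M')
    (ψ : N ≃ₗ[R] N') : ExtVanishesAt R M' N' n := by
  let i := φ.toModuleIso
  let j := ψ.toModuleIso
  refine subsingleton_of_forall_eq 0 fun x => ?_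
  have pulled_back : ((Abelian.Ext.mk₀ i.hom).comp x (zero_add n)).comp
      (Abelian.Ext.mk₀ j.inv) (add_zero n) = 0 := Subsingleton.elim _ _
  have recovered : (Abelian.Ext.mk₀ i.inv).comp ((((Abelian.Ext.mk₀ i.hom).comp x
      (zero_add n)).comp (Abelian.Ext.mk₀ j.inv) (add_zero n)).comp
      (Abelian.Ext.mk₀ j.hom) (add_zero n)) (zero_add n) = x := by simp
  rw [← recovered, pulled_back, Abelian.Ext.zero_comp, Abelian.Ext.comp_zero]

variable {f : M →ₗ[R] I} {g : I →ₗ[R] N}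

theorem shortExact_ofHom (hf : Function.Injective f) (hfg : Function.Exact f g)
    (hg : Function.Surjective g) :
    (ShortComplex.mk (ModuleCat.ofHom f) (ModuleCat.ofHom g)
      (ModuleCat.hom_ext hfg.linearMap_comp_eq_zero)).ShortExact where
  exact := (ShortComplex.ShortExact.moduleCat_exact_iff_function_exact _).2 hfg
  mono_f := (ModuleCat.mono_iff_injective _).2 hf
  epi_g := (ModuleCat.epi_iff_surjective _).2 hg

theorem extVanishesAt_covariant_left (hf : Function.Injective f) (hfg : Function.Exact f g)
    (hg : Function.Surjective g) {n : ℕ} (hN : ExtVanishesAt R X N n)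
    (hI : ExtVanishesAt R X I (n + 1)) : ExtVanishesAt R X M (n + 1) := by
  refine subsingleton_of_forall_eq 0 fun x => ?_
  obtain ⟨y, rfl⟩ := Abelian.Ext.covariant_sequence_exact₁ (ModuleCat.of R X)
    (shortExact_ofHom hf hfg hg) x (Subsingleton.elim _ _) rfl
  rw [@Subsingleton.elim _ hN y 0, Abelian.Ext.zero_comp]

theorem extVanishesAt_covariant_right (hf : Function.Injective f) (hfg : Function.Exact f g)
    (hg : Function.Surjective g) {n : ℕ} (hI : ExtVanishesAt R X I n)
    (hM : ExtVanishesAt R X M (n + 1)) : ExtVanishesAt R X N n := by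
  refine subsingleton_of_forall_eq 0 fun x => ?_
  obtain ⟨y, rfl⟩ := Abelian.Ext.covariant_sequence_exact₃ (ModuleCat.of R X)
    (shortExact_ofHom hf hfg hg) x rfl (Subsingleton.elim _ _)
  rw [@Subsingleton.elim _ hI y 0, Abelian.Ext.zero_comp]

theorem extVanishesAt_contravariant_left (hf : Function.Injective f)
    (hfg : Function.Exact f g) (hg : Function.Surjective g) {n : ℕ}
    (hI : ExtVanishesAt R I X n) (hN : ExtVanishesAt R N X (n + 1)) : ExtVanishesAt R M X n := by
  refine subsingleton_of_forall_eq 0 fun x => ?_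
  obtain ⟨y, rfl⟩ := Abelian.Ext.contravariant_sequence_exact₁
    (shortExact_ofHom hf hfg hg) (ModuleCat.of R X) x (add_comm 1 n) (Subsingleton.elim _ _)
  rw [@Subsingleton.elim _ hI y 0, Abelian.Ext.comp_zero]

theorem extVanishesAt_contravariant_right (hf : Function.Injective f)
    (hfg : Function.Exact f g) (hg : Function.Surjective g) {n : ℕ}
    (hM : ExtVanishesAt R M X n) (hI : ExtVanishesAt R I X (n + 1)) :
    ExtVanishesAt R N X (n + 1) := by
  refine subsingleton_of_forall_eq 0 fun x => ?_
  obtain ⟨y, rfl⟩ := Abelian.Ext.contravariant_sequence_exact₃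
    (shortExact_ofHom hf hfg hg) (ModuleCat.of R X) x (Subsingleton.elim _ _) (add_comm 1 n)
  rw [@Subsingleton.elim _ hM y 0, Abelian.Ext.comp_zero]

theorem exists_extension_of_extVanishesAt_one (hf : Function.Injective f)
    (hfg : Function.Exact f g) (hg : Function.Surjective g) (h : ExtVanishesAt R N X 1)
    (k : M →ₗ[R] X) : ∃ l : I →ₗ[R] X, l ∘ₗ f = k := by
  obtain ⟨y, hy⟩ := Abelian.Ext.contravariant_sequence_exact₁
    (shortExact_ofHom hf hfg hg) (ModuleCat.of R X) (Abelian.Ext.mk₀ (ModuleCat.ofHom k)) rfl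
    (Subsingleton.elim _ _)
  obtain ⟨l, rfl⟩ := (Abelian.Ext.mk₀_bijective _ _).2 y
  rw [Abelian.Ext.mk₀_comp_mk₀] at hy
  exact ⟨l.hom, congrArg ModuleCat.Hom.hom ((Abelian.Ext.mk₀_bijective _ _).1 hy)⟩

theorem extVanishesAt_one_of_forall_extension [Module.Projective R I]
    (hf : Function.Injective f) (hfg : Function.Exact f g) (hg : Function.Surjective g)
    (h : ∀ k : M →ₗ[R] X, ∃ l : I →ₗ[R] X, l ∘ₗ f = k) : ExtVanishesAt R N X 1 := by
  refine subsingleton_of_forall_eq 0 fun x => ?_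
  have := extVanishesAt_succ_of_projective (R := R) (M := I) (N := X) 0
  obtain ⟨y, rfl⟩ := Abelian.Ext.contravariant_sequence_exact₃
    (shortExact_ofHom hf hfg hg) (ModuleCat.of R X) x (Subsingleton.elim _ _) (add_zero 1)
  obtain ⟨k, rfl⟩ := (Abelian.Ext.mk₀_bijective _ _).2 y
  obtain ⟨l, hl⟩ := h k.hom
  have factors : k = ModuleCat.ofHom f ≫ ModuleCat.ofHom l := ModuleCat.hom_ext hl.symm
  have connecting := (shortExact_ofHom hf hfg hg).extClass_comp
  dsimp only at connecting
  rw [factors, ← Abelian.Ext.mk₀_comp_mk₀, ← Abelian.Ext.comp_assoc_of_second_deg_zero,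
    connecting, Abelian.Ext.zero_comp]

theorem extVanishesAt_one_of_forall_lift (hI : Module.Injective R I) (hf : Function.Injective f)
    (hfg : Function.Exact f g) (hg : Function.Surjective g)
    (h : ∀ k : X →ₗ[R] N, ∃ l : X →ₗ[R] I, g ∘ₗ l = k) : ExtVanishesAt R X M 1 := by
  refine subsingleton_of_forall_eq 0 fun x => ?_
  have := extVanishesAt_succ_of_injective (M := X) hI 0
  obtain ⟨y, rfl⟩ := Abelian.Ext.covariant_sequence_exact₁ (ModuleCat.of R X)
    (shortExact_ofHom hf hfg hg) x (Subsingleton.elim _ _) rfl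
  obtain ⟨k, rfl⟩ := (Abelian.Ext.mk₀_bijective _ _).2 y
  obtain ⟨l, hl⟩ := h k.hom
  have factors : k = ModuleCat.ofHom l ≫ ModuleCat.ofHom g := ModuleCat.hom_ext hl.symm
  have connecting := (shortExact_ofHom hf hfg hg).comp_extClass
  dsimp only at connecting
  rw [factors, ← Abelian.Ext.mk₀_comp_mk₀, Abelian.Ext.comp_assoc_of_second_deg_zero,
    connecting, Abelian.Ext.comp_zero]

theorem exact_mkQ_range (f : M →ₗ[R] I) : Function.Exact f (LinearMap.range f).mkQ :=
  LinearMap.exact_iff.2 (Submodule.ker_mkQ _)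

end ExtSequences

/-! ### Depth with respect to the modules killed by an idempotent -/

section Depth

/-- No nonzero submodule of `N` is annihilated by `e`. -/
def TorsionFree {R : Type u} [Ring R] (e : R) (N : Type*) [AddCommGroup N] [Module R N] : Prop :=
  ∀ x : N, (∀ r : R, (e * r) • x = 0) → x = 0

/-- `N` has depth at least `n` with respect to the modules killed by `e`: `Ext^i(X, N) = 0` for
all `i < n` and all `X` with `eX = 0`. For the idempotent of a gendo-symmetric algebra this is the
homological form of `n ≤ domdim N`, see `le_domdim_iff`. -/
def HasDepthGE {R : Type u} [Ring R] (e : R) (N : Type u) [AddCommGroup N] [Module R N] (n : ℕ) :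
    Prop :=
  ∀ X : ModuleCat.{u} R, (∀ x : X, e • x = 0) → ∀ i < n, ExtVanishesAt R X N i

variable {R : Type u} [Ring R] {e : R} {N : Type u} [AddCommGroup N] [Module R N]

theorem TorsionFree.eq_of_forall_smul_eq (h : TorsionFree e N) {x y : N}
    (hxy : ∀ r : R, (e * r) • x = (e * r) • y) : x = y :=
  sub_eq_zero.1 (h _ fun r => by rw [smul_sub, hxy, sub_self])

theorem hasDepthGE_zero : HasDepthGE e N 0 := fun _ _ _ hi => absurd hi (Nat.not_lt_zero _)

theorem hasDepthGE_one_iff : HasDepthGE e N 1 ↔ TorsionFree e N := by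
  constructor
  · intro h x hx
    have killed : ∀ y : Submodule.span R {x}, e • y = 0 := by
      rintro ⟨y, hy⟩
      obtain ⟨r, rfl⟩ := Submodule.mem_span_singleton.1 hy
      exact Subtype.ext ((mul_smul e r x).symm.trans (hx r))
    have := extVanishesAt_zero_iff.1 (h (ModuleCat.of R (Submodule.span R {x})) killed 0 one_pos)
      (Submodule.subtype _)
    exact DFunLike.congr_fun this ⟨x, Submodule.mem_span_singleton_self x⟩
  · intro h X hX i hi
    obtain rfl := Nat.lt_one_iff.1 hi
    refine extVanishesAt_zero_iff.2 fun f => LinearMap.ext fun x => h _ fun r => ?_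
    rw [mul_smul, ← map_smul, ← map_smul, hX, map_zero]

theorem HasDepthGE.mono {m n : ℕ} (h : HasDepthGE e N n) (hmn : m ≤ n) : HasDepthGE e N m :=
  fun X hX i hi => h X hX i (hi.trans_le hmn)

theorem HasDepthGE.torsionFree {n : ℕ} (h : HasDepthGE e N (n + 1)) : TorsionFree e N :=
  hasDepthGE_one_iff.1 (h.mono (Nat.le_add_left 1 n))

theorem HasDepthGE.exists_eq_smul (h : HasDepthGE e N 2) (u : R →+ N)
    (hu : ∀ x y, u (x * e * y) = (e * x) • u y) : ∃ n : N, ∀ y, u y = (e * y) • n := by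
  -- `u` induces a map `ReR → N`, whose graph is the submodule `G`.
  let G : Submodule R (R × N) := Submodule.span R (Set.range fun y => (e * y, u y))
  have mem_G : ∀ y, (e * y, u y) ∈ G := fun y => Submodule.subset_span ⟨y, rfl⟩
  have smul_snd : ∀ p ∈ G, ∀ r, (e * r) • p.2 = u (r * p.1) := fun p hp r => by
    induction hp using Submodule.span_induction generalizing r with
    | mem p hp => obtain ⟨y, rfl⟩ := hp; rw [← hu, mul_assoc]
    | zero => simp
    | add p q _ _ hp hq => simp [mul_add, hp, hq]
    | smul s p _ hp => rw [Prod.smul_snd, smul_smul, mul_assoc, hp, Prod.smul_fst, smul_eq_mul,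
        mul_assoc]
  let π : G →ₗ[R] R := LinearMap.fst R R N ∘ₗ G.subtype
  have π_injective : Function.Injective π := by
    refine (injective_iff_map_eq_zero π).2 fun ⟨p, hp⟩ hπ => Subtype.ext (Prod.ext hπ ?_)
    refine h.torsionFree _ fun r => ?_
    rw [smul_snd p hp, show p.1 = 0 from hπ, mul_zero, map_zero]
  have killed : ∀ x : R ⧸ LinearMap.range π, e • x = 0 := fun x => by
    obtain ⟨y, rfl⟩ := Submodule.mkQ_surjective _ x
    exact (Submodule.Quotient.mk_eq_zero _).2 ⟨⟨_, mem_G y⟩, rfl⟩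
  obtain ⟨k, hk⟩ := exists_extension_of_extVanishesAt_one π_injective (exact_mkQ_range π)
    (Submodule.mkQ_surjective _) (h (ModuleCat.of R _) killed 1 one_lt_two)
    (LinearMap.snd R R N ∘ₗ G.subtype)
  refine ⟨k 1, fun y => ?_⟩
  rw [← map_smul, smul_eq_mul, mul_one]
  exact (DFunLike.congr_fun hk ⟨_, mem_G y⟩).symm

section Converse

variable {K : Type*} [CommRing K] [Algebra K R] [Module K N] [IsScalarTower K R N]

theorem TorsionFree.exists_extension (hN : TorsionFree e N)
    (h : ∀ u : R →ₗ[K] N, (∀ x y, u (x * e * y) = (e * x) • u y) → ∃ n, ∀ y, u y = (e * y) • n)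
    {P : Type*} [AddCommGroup P] [Module R P] {L : Submodule R P} (hL : ∀ p, e • p ∈ L)
    (φ : L →ₗ[R] N) : ∃ k : P →ₗ[R] N, k ∘ₗ L.subtype = φ := by
  let _ : Module K P := Module.compHom P (algebraMap K R)
  have : IsScalarTower K R P := IsScalarTower.of_algebraMap_smul fun _ _ => rfl
  have mem_L : ∀ y p, (e * y) • p ∈ L := fun y p => mul_smul e y p ▸ hL _
  have pointwise : ∀ p, ∃ n, ∀ y, φ ⟨(e * y) • p, mem_L y p⟩ = (e * y) • n := fun p => by
    refine h ((φ.restrictScalars K) ∘ₗ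
      { toFun := fun y => ⟨(e * y) • p, mem_L y p⟩
        map_add' := fun x y => Subtype.ext (by simp [mul_add, add_smul])
        map_smul' := fun c y => Subtype.ext (by simp) }) fun x y => ?_
    rw [LinearMap.comp_apply, LinearMap.comp_apply, LinearMap.coe_restrictScalars, ← map_smul]
    exact congrArg φ (Subtype.ext (by simp [smul_smul, mul_assoc]))
  choose k hk using pointwise
  let extension : P →ₗ[R] N :=
    { toFun := k
      map_add' := fun p q => hN.eq_of_forall_smul_eq fun y => by
        rw [smul_add, ← hk, ← hk, ← hk, ← map_add]
        exact congrArg φ (Subtype.ext (smul_add _ _ _))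
      map_smul' := fun r p => hN.eq_of_forall_smul_eq fun y => by
        rw [RingHom.id_apply, smul_smul, mul_assoc, ← hk, ← hk]
        exact congrArg φ (Subtype.ext (by simp [smul_smul, mul_assoc])) }
  refine ⟨extension, LinearMap.ext fun p => hN.eq_of_forall_smul_eq fun y => ?_⟩
  exact (hk p y).symm.trans (map_smul φ (e * y) p)

theorem HasDepthGE.two_of_forall_exists_eq_smul (hN : TorsionFree e N)
    (h : ∀ u : R →ₗ[K] N, (∀ x y, u (x * e * y) = (e * x) • u y) → ∃ n, ∀ y, u y = (e * y) • n) :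
    HasDepthGE e N 2 := fun X hX i hi => by
  obtain rfl | rfl : i = 0 ∨ i = 1 := by omega
  · exact hasDepthGE_one_iff.2 hN X hX 0 one_pos
  let π : (X →₀ R) →ₗ[R] X := Finsupp.linearCombination R id
  have exact_π : Function.Exact (LinearMap.ker π).subtype π := LinearMap.exact_subtype_ker_map π
  refine extVanishesAt_one_of_forall_extension (Submodule.injective_subtype _) exact_π
    (Finsupp.linearCombination_id_surjective R X) (hN.exists_extension h fun p => ?_)
  rw [LinearMap.mem_ker, map_smul, hX]

end Converse

variable {M I : Type u} [AddCommGroup M] [Module R M] [AddCommGroup I] [Module R I]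

theorem TorsionFree.of_injective (h : TorsionFree e I) (f : M →ₗ[R] I)
    (hf : Function.Injective f) : TorsionFree e M := fun _ hx =>
  hf <| by rw [map_zero]; exact h _ fun r => by rw [← map_smul, hx, map_zero]

theorem TorsionFree.pi {ι : Type*} {N : ι → Type*} [∀ i, AddCommGroup (N i)]
    [∀ i, Module R (N i)] (h : ∀ i, TorsionFree e (N i)) : TorsionFree e (∀ i, N i) := fun _ hx =>
  funext fun i => h i _ fun r => congrFun (hx r) i

theorem HasDepthGE.of_linearEquiv {n : ℕ} (h : HasDepthGE e M n) (φ : M ≃ₗ[R] N) :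
    HasDepthGE e N n :=
  fun X hX i hi => (h X hX i hi).of_linearEquiv (LinearEquiv.refl R X) φ

theorem TorsionFree.hasDepthGE_of_injective (h : TorsionFree e I) (hI : Module.Injective R I)
    (n : ℕ) : HasDepthGE e I n := fun X hX i _ => by
  rcases i with _ | i
  · exact hasDepthGE_one_iff.2 h X hX 0 one_pos
  · exact extVanishesAt_succ_of_injective hI i

variable {f : M →ₗ[R] I} {g : I →ₗ[R] N}

theorem HasDepthGE.of_cosyzygy {n : ℕ} (h : HasDepthGE e N n) (hI : HasDepthGE e I (n + 1))
    (hf : Function.Injective f) (hfg : Function.Exact f g) (hg : Function.Surjective g) :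
    HasDepthGE e M (n + 1) := fun X hX i hi => by
  rcases i with _ | i
  · exact hasDepthGE_one_iff.2 (hI.torsionFree.of_injective f hf) X hX 0 one_pos
  · exact extVanishesAt_covariant_left hf hfg hg (h X hX i (by omega)) (hI X hX (i + 1) hi)

theorem HasDepthGE.cosyzygy {n : ℕ} (h : HasDepthGE e M (n + 1)) (hI : HasDepthGE e I n)
    (hf : Function.Injective f) (hfg : Function.Exact f g) (hg : Function.Surjective g) :
    HasDepthGE e N n := fun X hX i hi =>
  extVanishesAt_covariant_right hf hfg hg (hI X hX i hi) (h X hX (i + 1) (by omega))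

end Depth

/-- A symmetrising form on `eRe`, for an idempotent `e` such that `Re` and `eR` are faithful. The
form is extended from `eRe` to `R` by `l a = l (e * a * e)`. -/
structure FaithfulSymmetricCorner (K : Type*) [Field K] (R : Type u) [Ring R] [Algebra K R]
    (e : R) (l : R →ₗ[K] K) : Prop where
  idem : IsIdempotentElem e
  map_mul_e : ∀ a, l (a * e) = l a
  symm : ∀ x y, l (x * e * y) = l (y * e * x)
  nondegenerate : ∀ x, (∀ r, l (r * (e * x * e)) = 0) → e * x * e = 0
  faithful_left : ∀ a, (∀ b, e * b * a = 0) → a = 0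
  faithful_right : ∀ a, (∀ b, a * b * e = 0) → a = 0

/-- The double centraliser property of `e`: the `eRe`-balanced forms on `eR × Re`, that is, the
elements of `D(Re ⊗ eR)`, are the forms `(y, r) ↦ l (y * a * r)` with `a ∈ R`. Unlike the
bijectivity of `R → End (Re)`, this form of the property is visibly left-right symmetric. -/
def DoubleCentralizer {K : Type*} [Field K] {R : Type u} [Ring R] [Algebra K R]
    (e : R) (l : R →ₗ[K] K) : Prop :=
  ∀ B : R →ₗ[K] R →ₗ[K] K, (∀ y r, B (e * y) r = B y r) → (∀ y r, B y (r * e) = B y r) →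
    (∀ x y r, B (x * e * y) r = B y (r * e * x)) → ∃ a, ∀ y r, B y r = l (y * a * r)

namespace FaithfulSymmetricCorner

variable {K : Type*} [Field K] {R : Type u} [Ring R] [Algebra K R] {e : R} {l : R →ₗ[K] K}

theorem map_e_mul (h : FaithfulSymmetricCorner K R e l) (a : R) : l (e * a) = l a := by
  have := h.symm 1 a
  rwa [one_mul, mul_one, h.map_mul_e] at this

theorem mul_e_eq_zero (h : FaithfulSymmetricCorner K R e l) {z : R} (hz : ∀ r, l (r * z) = 0) :
    z * e = 0 := by
  refine h.faithful_left _ fun s => ?_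
  rw [← mul_assoc, mul_assoc e]
  refine h.nondegenerate _ fun r => ?_
  rw [← mul_assoc, h.map_mul_e, ← mul_assoc, ← mul_assoc, hz]

theorem e_mul_eq_zero (h : FaithfulSymmetricCorner K R e l) {y : R} (hy : ∀ r, l (y * r) = 0) :
    e * y = 0 := by
  refine h.faithful_right _ fun s => ?_
  rw [mul_assoc e]
  refine h.nondegenerate _ fun r => ?_
  rw [← mul_assoc, h.map_mul_e, ← mul_assoc, h.symm, mul_assoc, mul_assoc, hy]

theorem mul_e_of_mem (h : FaithfulSymmetricCorner K R e l) (z : leftIdeal R e) :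
    (z : R) * e = z := by
  obtain ⟨z, a, rfl⟩ := z
  rw [mul_assoc, h.idem]

theorem leftIdeal_ext (h : FaithfulSymmetricCorner K R e l) {z w : leftIdeal R e}
    (hzw : ∀ r : R, l (r * z) = l (r * w)) : z = w := by
  have := h.mul_e_eq_zero (z := z - w) fun r => by rw [mul_sub, map_sub, hzw, sub_self]
  rw [sub_mul, h.mul_e_of_mem, h.mul_e_of_mem, sub_eq_zero] at this
  exact Subtype.ext this

theorem torsionFree_self (h : FaithfulSymmetricCorner K R e l) : TorsionFree e R :=
  h.faithful_left

theorem torsionFree_leftIdeal (h : FaithfulSymmetricCorner K R e l) :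
    TorsionFree e (leftIdeal R e) :=
  h.torsionFree_self.of_injective (Submodule.subtype _) (Submodule.subtype_injective _)

theorem torsionFree_pi_leftIdeal (h : FaithfulSymmetricCorner K R e l) (m : ℕ) :
    TorsionFree e (Fin m → leftIdeal R e) :=
  TorsionFree.pi fun _ => h.torsionFree_leftIdeal

theorem torsionFree_of_projective (h : FaithfulSymmetricCorner K R e l) {P : Type u}
    [AddCommGroup P] [Module R P] [Module.Projective R P] : TorsionFree e P := by
  obtain ⟨s, hs⟩ := Module.projective_def'.1 ‹Module.Projective R P›
  have s_injective : Function.Injective s :=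
    Function.LeftInverse.injective (g := Finsupp.linearCombination R id) (DFunLike.congr_fun hs)
  exact (TorsionFree.pi fun _ => h.torsionFree_self).of_injective
    (Finsupp.lcoeFun ∘ₗ s) (DFunLike.coe_injective.comp s_injective)

theorem projective_leftIdeal (h : FaithfulSymmetricCorner K R e l) :
    Module.Projective R (leftIdeal R e) := by
  refine Module.Projective.of_split (Submodule.subtype _)
    ((LinearMap.toSpanSingleton R R e).codRestrict _ fun x => ⟨x, rfl⟩) ?_
  ext z
  exact h.mul_e_of_mem z

theorem projective_pi_leftIdeal (h : FaithfulSymmetricCorner K R e l) (m : ℕ) :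
    Module.Projective R (Fin m → leftIdeal R e) := by
  have := h.projective_leftIdeal
  exact Module.Projective.of_equiv
    (DFinsupp.linearEquivFunOnFintype (R := R) (M := fun _ : Fin m => leftIdeal R e))

section FiniteDimensional

variable [FiniteDimensional K R]

theorem exists_map_mul_right_eq (h : FaithfulSymmetricCorner K R e l) {ψ : R →ₗ[K] K}
    (hψ : ∀ r, ψ (e * r) = ψ r) : ∃ z, ∀ r, ψ r = l (r * z) := by
  let Λ : R →ₗ[K] Module.Dual K R := (LinearMap.mul K R).flip.compr₂ l
  suffices ψ ∈ LinearMap.range Λ by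
    obtain ⟨z, rfl⟩ := this
    exact ⟨z, fun _ => rfl⟩
  rw [← Subspace.dualCoannihilator_dualAnnihilator_eq (W := LinearMap.range Λ),
    Submodule.mem_dualAnnihilator]
  intro r hr
  have : e * r = 0 := h.e_mul_eq_zero fun z =>
    (Submodule.mem_dualCoannihilator r).1 hr (Λ z) ⟨z, rfl⟩
  rw [← hψ, this, map_zero]

theorem exists_map_mul_left_eq (h : FaithfulSymmetricCorner K R e l) {ψ : R →ₗ[K] K}
    (hψ : ∀ r, ψ (r * e) = ψ r) : ∃ y, ∀ r, ψ r = l (y * r) := by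
  let Λ : R →ₗ[K] Module.Dual K R := (LinearMap.mul K R).compr₂ l
  suffices ψ ∈ LinearMap.range Λ by
    obtain ⟨y, rfl⟩ := this
    exact ⟨y, fun _ => rfl⟩
  rw [← Subspace.dualCoannihilator_dualAnnihilator_eq (W := LinearMap.range Λ),
    Submodule.mem_dualAnnihilator]
  intro r hr
  have : r * e = 0 := h.mul_e_eq_zero fun y =>
    (Submodule.mem_dualCoannihilator r).1 hr (Λ y) ⟨y, rfl⟩
  rw [← hψ, this, map_zero]

section LinearForms

variable {X : Type*} [AddCommGroup X] [Module R X] [Module K X] [IsScalarTower K R X]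

theorem exists_linearMap_leftIdeal (h : FaithfulSymmetricCorner K R e l) {ξ : X →ₗ[K] K}
    (hξ : ∀ x, ξ (e • x) = ξ x) : ∃ f : X →ₗ[R] leftIdeal R e, ∀ x, l (f x) = ξ x := by
  have represent : ∀ x, ∃ z : leftIdeal R e, ∀ r : R, ξ (r • x) = l (r * z) := by
    intro x
    obtain ⟨z, hz⟩ := h.exists_map_mul_right_eq
      (ψ := ξ ∘ₗ (LinearMap.toSpanSingleton R X x).restrictScalars K)
      (fun r => by simp [mul_smul, hξ])
    refine ⟨⟨z * e, z, rfl⟩, fun r => ?_⟩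
    rw [← mul_assoc, h.map_mul_e]
    exact hz r
  choose F hF using represent
  refine ⟨⟨⟨F, fun x y => h.leftIdeal_ext fun r => ?_⟩,
    fun s x => h.leftIdeal_ext fun r => ?_⟩, fun x => ?_⟩
  · simp only [← hF, smul_add, map_add, Submodule.coe_add, mul_add]
  · simp [← hF, smul_smul, ← mul_assoc]
  · simpa using (hF x 1).symm

theorem exists_linearMap_leftIdeal_smul (h : FaithfulSymmetricCorner K R e l) (ξ : X →ₗ[K] K) :
    ∃ f : X →ₗ[R] leftIdeal R e, ∀ x, l (f x) = ξ (e • x) :=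
  h.exists_linearMap_leftIdeal (ξ := ξ ∘ₗ (Algebra.lsmul K K X e)) fun x => by
    simp [smul_smul, h.idem.eq]

end LinearForms

theorem injective_leftIdeal (h : FaithfulSymmetricCorner K R e l) :
    Module.Injective R (leftIdeal R e) := by
  refine ⟨fun X Y _ _ _ _ f hf g => ?_⟩
  let _ : Module K X := Module.compHom X (algebraMap K R)
  let _ : Module K Y := Module.compHom Y (algebraMap K R)
  have : IsScalarTower K R X := IsScalarTower.of_algebraMap_smul fun _ _ => rfl
  have : IsScalarTower K R Y := IsScalarTower.of_algebraMap_smul fun _ _ => rfl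
  obtain ⟨ρ, hρ⟩ := LinearMap.exists_leftInverse_of_injective (f.restrictScalars K)
    (LinearMap.ker_eq_bot.2 hf)
  have retract : ∀ x, ρ (f x) = x := fun x => DFunLike.congr_fun hρ x
  obtain ⟨k, hk⟩ := h.exists_linearMap_leftIdeal_smul (X := Y)
    (l ∘ₗ ((Submodule.subtype _ ∘ₗ g).restrictScalars K) ∘ₗ ρ)
  refine ⟨k, fun x => h.leftIdeal_ext fun s => ?_⟩
  calc l (s * k (f x)) = l (k (f (s • x))) := by simp
    _ = l (g (e • s • x)) := by
      rw [hk, ← map_smul, LinearMap.comp_apply, LinearMap.comp_apply, retract]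
      rfl
    _ = l (s * g x) := by simp [h.map_e_mul]

theorem injective_pi_leftIdeal (h : FaithfulSymmetricCorner K R e l) (m : ℕ) :
    Module.Injective R (Fin m → leftIdeal R e) := by
  have := h.injective_leftIdeal
  infer_instance

theorem hasDepthGE_pi_leftIdeal (h : FaithfulSymmetricCorner K R e l) (m n : ℕ) :
    HasDepthGE e (Fin m → leftIdeal R e) n :=
  (h.torsionFree_pi_leftIdeal m).hasDepthGE_of_injective (h.injective_pi_leftIdeal m) n

theorem exists_injective_pi_leftIdeal (h : FaithfulSymmetricCorner K R e l)
    {N : Type*} [AddCommGroup N] [Module R N] [Module.Finite R N] (hN : TorsionFree e N) :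
    ∃ (m : ℕ) (f : N →ₗ[R] (Fin m → leftIdeal R e)), Function.Injective f := by
  let _ : Module K N := Module.compHom N (algebraMap K R)
  have : IsScalarTower K R N := IsScalarTower.of_algebraMap_smul fun _ _ => rfl
  have : Module.Finite K N := Module.Finite.trans R N
  let b := Module.finBasis K (Module.Dual K N)
  choose f hf using fun j => h.exists_linearMap_leftIdeal_smul (b j)
  refine ⟨_, LinearMap.pi f, (injective_iff_map_eq_zero _).2 fun x hx => hN x fun r => ?_⟩
  have basis_vanishes : ∀ j, b j ((e * r) • x) = 0 := fun j => by
    rw [mul_smul, ← hf, map_smul, show f j x = 0 from congrFun hx j, smul_zero,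
      ZeroMemClass.coe_zero, map_zero]
  refine (Module.forall_dual_apply_eq_zero_iff K _).1 fun φ => ?_
  rw [← b.sum_repr φ, LinearMap.sum_apply]
  exact Finset.sum_eq_zero fun j _ => by rw [LinearMap.smul_apply, basis_vanishes, smul_zero]

variable {N : Type u} [AddCommGroup N] [Module R N] [Module.Finite R N]

theorem projective_of_injective (h : FaithfulSymmetricCorner K R e l) (hI : Module.Injective R N)
    (ht : TorsionFree e N) : Module.Projective R N := by
  obtain ⟨m, f, hf⟩ := h.exists_injective_pi_leftIdeal ht
  obtain ⟨p, hp⟩ := hI.out f hf LinearMap.id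
  have := h.projective_pi_leftIdeal m
  exact Module.Projective.of_split f p (LinearMap.ext hp)

theorem exists_cosyzygy (h : FaithfulSymmetricCorner K R e l) {n : ℕ}
    (hN : HasDepthGE e N (n + 1)) :
    ∃ (m : ℕ) (f : N →ₗ[R] (Fin m → leftIdeal R e)), Function.Injective f ∧
      HasDepthGE e ((Fin m → leftIdeal R e) ⧸ LinearMap.range f) n := by
  obtain ⟨m, f, hf⟩ := h.exists_injective_pi_leftIdeal hN.torsionFree
  exact ⟨m, f, hf, hN.cosyzygy (h.hasDepthGE_pi_leftIdeal m n) hf (exact_mkQ_range f)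
    (Submodule.mkQ_surjective _)⟩

theorem doubleCentralizer_of_hasDepthGE (h : FaithfulSymmetricCorner K R e l)
    (hR : HasDepthGE e R 2) : DoubleCentralizer e l := by
  intro B _ B_right B_balanced
  choose u hu using fun y => h.exists_map_mul_left_eq (B_right y)
  have ext : ∀ x y, (∀ r, l (x * r) = l (y * r)) → e * x = e * y := fun x y hxy =>
    sub_eq_zero.1 <| mul_sub e x y ▸ h.e_mul_eq_zero fun r => by
      rw [sub_mul, map_sub, hxy, sub_self]
  let v : R →+ R := AddMonoidHom.mk' (fun y => e * u y) fun x y => by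
    rw [← mul_add]
    exact ext _ _ fun r => by rw [← hu, map_add, add_mul, map_add, LinearMap.add_apply, hu, hu]
  have hv : ∀ x y, v (x * e * y) = (e * x) • v y := fun x y => by
    change e * u (x * e * y) = e * x * (e * u y)
    rw [mul_assoc e x]
    refine ext _ _ fun r => ?_
    rw [← hu, B_balanced, hu, ← mul_assoc, ← mul_assoc x, mul_assoc _ (u y), h.symm, ← mul_assoc]
  obtain ⟨a, ha⟩ := hR.exists_eq_smul v hv
  refine ⟨a, fun y r => ?_⟩
  calc B y r = l (v y * r) := by
        rw [hu, ← h.map_e_mul, ← mul_assoc]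
        rfl
    _ = l (y * a * r) := by rw [ha, smul_eq_mul, mul_assoc, mul_assoc, h.map_e_mul, mul_assoc]

end FiniteDimensional

theorem hasDepthGE_of_doubleCentralizer (h : FaithfulSymmetricCorner K R e l)
    (hD : DoubleCentralizer e l) : HasDepthGE e R 2 := by
  refine .two_of_forall_exists_eq_smul (K := K) h.torsionFree_self fun u hu => ?_
  have e_mul_u : ∀ y, e * u y = u y := fun y => h.torsionFree_self.eq_of_forall_smul_eq fun r => by
    have := hu (r * e) y
    rw [mul_assoc r, h.idem.eq, hu] at this
    simpa only [smul_eq_mul, mul_assoc] using this.symm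
  obtain ⟨a, ha⟩ := hD ((LinearMap.mul K R).compr₂ l ∘ₗ u)
    (fun y r => by
      have := hu 1 y
      rw [one_mul, mul_one, smul_eq_mul, e_mul_u] at this
      simp [this])
    (fun y r => by simp [← mul_assoc, h.map_mul_e])
    (fun x y r => by
      change l (u (x * e * y) * r) = l (u y * (r * e * x))
      rw [hu, smul_eq_mul, mul_assoc, mul_assoc, h.map_e_mul, ← mul_assoc (u y), ← mul_assoc (u y),
        h.symm, mul_assoc x, ← mul_assoc e, e_mul_u])
  refine ⟨a, fun y => ?_⟩
  have : e * (u y - y * a) = 0 := h.e_mul_eq_zero fun r => by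
    rw [sub_mul, map_sub, sub_eq_zero]
    exact ha y r
  rwa [mul_sub, e_mul_u, sub_eq_zero, ← mul_assoc] at this

end FaithfulSymmetricCorner

/-! ### Duality over the base field -/

section Duality

variable {K : Type u} [Field K] {R S : Type u} [Ring R] [Algebra K R] [Ring S] [Algebra K S]

/-- The inverse of an anti-isomorphism, again as an anti-isomorphism. -/
def antiSymm (θ : R ≃ₐ[K] Sᵐᵒᵖ) : S ≃ₐ[K] Rᵐᵒᵖ := (AlgEquiv.opComm θ).symm

theorem antiSymm_apply (θ : R ≃ₐ[K] Sᵐᵒᵖ) (s : S) : antiSymm θ s = op (θ.symm (op s)) := rfl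

/-- The `K`-dual of an `R`-module, as a module over the algebra `S` anti-isomorphic to `R`. -/
def DualMod (_ : R ≃ₐ[K] Sᵐᵒᵖ) (M : Type u) [AddCommGroup M] [Module K M] : Type u :=
  Module.Dual K M

namespace DualMod

section Module

variable (θ : R ≃ₐ[K] Sᵐᵒᵖ) (M : Type u) [AddCommGroup M] [Module K M]

noncomputable instance : AddCommGroup (DualMod θ M) :=
  inferInstanceAs (AddCommGroup (Module.Dual K M))

noncomputable instance : Module K (DualMod θ M) :=
  inferInstanceAs (Module K (Module.Dual K M))

instance [FiniteDimensional K M] : FiniteDimensional K (DualMod θ M) :=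
  inferInstanceAs (FiniteDimensional K (Module.Dual K M))

variable {θ M}

/-- The linear form underlying an element of `DualMod θ M`. -/
def toDual (φ : DualMod θ M) : Module.Dual K M := φ

theorem ext {φ ψ : DualMod θ M} (h : ∀ m, φ.toDual m = ψ.toDual m) : φ = ψ :=
  LinearMap.ext (f := φ.toDual) (g := ψ.toDual) h

variable (θ M) [Module R M] [IsScalarTower K R M]

noncomputable instance : Module S (DualMod θ M) where
  smul s φ := φ.toDual ∘ₗ Algebra.lsmul K K M (θ.symm (op s))
  one_smul φ := ext fun m => by
    change φ.toDual (θ.symm (op 1) • m) = φ.toDual m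
    rw [op_one, map_one, one_smul]
  mul_smul s t φ := ext fun m => by
    change φ.toDual (θ.symm (op (s * t)) • m) = φ.toDual (θ.symm (op t) • θ.symm (op s) • m)
    rw [op_mul, map_mul, mul_smul]
  smul_zero _ := rfl
  smul_add _ _ _ := rfl
  add_smul s t φ := ext fun m => by
    change φ.toDual (θ.symm (op (s + t)) • m) =
      φ.toDual (θ.symm (op s) • m) + φ.toDual (θ.symm (op t) • m)
    rw [MulOpposite.op_add, map_add, add_smul, map_add]
  zero_smul φ := ext fun m => by
    change φ.toDual (θ.symm (op 0) • m) = 0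
    rw [op_zero, map_zero, zero_smul, map_zero]

theorem smul_toDual (s : S) (φ : DualMod θ M) (m : M) :
    (s • φ).toDual m = φ.toDual (θ.symm (op s) • m) := rfl

instance : IsScalarTower K S (DualMod θ M) :=
  ⟨fun c s φ => ext fun m => by
    rw [smul_toDual, op_smul, map_smul θ.symm, smul_assoc]
    exact φ.toDual.map_smul c _⟩

end Module

variable (θ : R ≃ₐ[K] Sᵐᵒᵖ)

section Functoriality

variable {M I N : Type u} [AddCommGroup M] [Module K M] [Module R M] [IsScalarTower K R M]
  [AddCommGroup I] [Module K I] [Module R I] [IsScalarTower K R I]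
  [AddCommGroup N] [Module K N] [Module R N] [IsScalarTower K R N]

/-- The dual of an `R`-linear map. -/
noncomputable def map (f : M →ₗ[R] N) : DualMod θ N →ₗ[S] DualMod θ M where
  toFun φ := φ.toDual ∘ₗ f.restrictScalars K
  map_add' _ _ := rfl
  map_smul' _ φ := ext fun m => congrArg φ.toDual (f.map_smul _ m).symm

theorem map_surjective {f : M →ₗ[R] N} (hf : Function.Injective f) :
    Function.Surjective (map θ f) :=
  LinearMap.dualMap_surjective_of_injective (f := f.restrictScalars K) hf

theorem map_injective {f : M →ₗ[R] N} (hf : Function.Surjective f) :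
    Function.Injective (map θ f) :=
  LinearMap.dualMap_injective_of_surjective (f := f.restrictScalars K) hf

theorem map_exact {f : M →ₗ[R] I} {g : I →ₗ[R] N} (hfg : Function.Exact f g)
    (hg : Function.Surjective g) : Function.Exact (map θ g) (map θ f) := by
  have range_g := LinearMap.range_dualMap_eq_dualAnnihilator_ker_of_surjective
    (g.restrictScalars K) hg
  have ker_f := (f.restrictScalars K).ker_dualMap_eq_dualAnnihilator_range
  have ker_g : LinearMap.ker (g.restrictScalars K) = LinearMap.range (f.restrictScalars K) :=
    LinearMap.exact_iff.1 (show Function.Exact (f.restrictScalars K) (g.restrictScalars K) from hfg)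
  have dual_exact : Function.Exact (g.restrictScalars K).dualMap (f.restrictScalars K).dualMap :=
    LinearMap.exact_iff.2 (by rw [ker_f, range_g, ker_g])
  exact dual_exact

/-- The canonical isomorphism from a finite-dimensional module to its double dual. -/
noncomputable def evalEquiv (M : Type u) [AddCommGroup M] [Module K M] [Module R M]
    [IsScalarTower K R M] [FiniteDimensional K M] :
    M ≃ₗ[R] DualMod (antiSymm θ) (DualMod θ M) :=
  { Module.evalEquiv K M with
    map_smul' := fun r m => ext fun (φ : DualMod θ M) => by
      change φ.toDual (r • m) = φ.toDual (θ.symm (θ r) • m)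
      rw [AlgEquiv.symm_apply_apply] }

theorem evalEquiv_toDual [FiniteDimensional K M] (m : M) (φ : DualMod θ M) :
    (evalEquiv θ M m).toDual φ = φ.toDual m := rfl

variable {X : Type u} [AddCommGroup X] [Module K X] [Module S X] [IsScalarTower K S X]

/-- The adjunction `Hom_S(X, DM) → Hom_R(M, DX)`, exchanging the arguments of a pairing. -/
noncomputable def transpose (g : X →ₗ[S] DualMod θ M) : M →ₗ[R] DualMod (antiSymm θ) X where
  toFun m := Module.Dual.eval K M m ∘ₗ (g.restrictScalars K : X →ₗ[K] Module.Dual K M)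
  map_add' x y := ext fun φ => map_add (g φ).toDual x y
  map_smul' r m := ext fun x => by
    change (g x).toDual (r • m) = (g ((θ r).unop • x)).toDual m
    rw [g.map_smul, smul_toDual, op_unop, AlgEquiv.symm_apply_apply]

theorem transpose_toDual (g : X →ₗ[S] DualMod θ M) (m : M) (x : X) :
    (transpose θ g m).toDual x = (g x).toDual m := rfl

end Functoriality

section Ext

variable {M : Type u} [AddCommGroup M] [Module K M] [Module R M] [IsScalarTower K R M]

theorem injective_of_projective [Module.Projective R M] :
    Module.Injective S (DualMod θ M) := by
  refine ⟨fun X Y _ _ _ _ f hf g => ?_⟩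
  let _ : Module K X := Module.compHom X (algebraMap K S)
  let _ : Module K Y := Module.compHom Y (algebraMap K S)
  have : IsScalarTower K S X := IsScalarTower.of_algebraMap_smul fun _ _ => rfl
  have : IsScalarTower K S Y := IsScalarTower.of_algebraMap_smul fun _ _ => rfl
  obtain ⟨k, hk⟩ := Module.projective_lifting_property (map (antiSymm θ) f) (transpose θ g)
    (map_surjective (antiSymm θ) hf)
  refine ⟨transpose (antiSymm θ) k, fun x => ext fun m => ?_⟩
  calc (k m).toDual (f x) = (transpose θ g m).toDual x :=
        congrArg (toDual · x) (LinearMap.congr_fun hk m)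
    _ = (g x).toDual m := transpose_toDual θ g m x

variable {Y : Type u} [AddCommGroup Y] [Module K Y] [Module R Y] [IsScalarTower K R Y]
  [FiniteDimensional K Y]

theorem extVanishesAt_one_dual {W P X : Type u} [AddCommGroup W] [Module K W] [Module R W]
    [IsScalarTower K R W] [AddCommGroup P] [Module K P] [Module R P] [IsScalarTower K R P]
    [AddCommGroup X] [Module K X] [Module R X] [IsScalarTower K R X] [Module.Projective R P]
    {f : W →ₗ[R] P} {g : P →ₗ[R] X} (hf : Function.Injective f) (hfg : Function.Exact f g)
    (hg : Function.Surjective g) (h : ExtVanishesAt R X Y 1) :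
    ExtVanishesAt S (DualMod θ Y) (DualMod θ X) 1 := by
  refine extVanishesAt_one_of_forall_lift (injective_of_projective θ) (map_injective θ hg)
    (map_exact θ hfg hg) (map_surjective θ hf) fun k => ?_
  obtain ⟨l, hl⟩ := exists_extension_of_extVanishesAt_one hf hfg hg h
    ((evalEquiv θ Y).symm.toLinearMap ∘ₗ transpose θ k)
  refine ⟨map θ l, LinearMap.ext fun φ => ext fun w => ?_⟩
  have l_f : l (f w) = (evalEquiv θ Y).symm (transpose θ k w) := LinearMap.congr_fun hl w
  change φ.toDual (l (f w)) = (k φ).toDual w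
  rw [l_f, ← evalEquiv_toDual, LinearEquiv.apply_symm_apply, transpose_toDual]

theorem extVanishesAt_succ_dual (n : ℕ) (X : Type u) [AddCommGroup X] [Module K X] [Module R X]
    [IsScalarTower K R X] (h : ExtVanishesAt R X Y (n + 1)) :
    ExtVanishesAt S (DualMod θ Y) (DualMod θ X) (n + 1) := by
  induction n generalizing X with
  | zero =>
    exact extVanishesAt_one_dual θ (Submodule.subtype_injective _)
      (LinearMap.exact_subtype_ker_map _) (Finsupp.linearCombination_id_surjective R X) h
  | succ n ih =>
    let p := Finsupp.linearCombination R (id : X → X)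
    have p_surjective : Function.Surjective p := Finsupp.linearCombination_id_surjective R X
    have kernel_injective := Submodule.subtype_injective (LinearMap.ker p)
    have p_exact := LinearMap.exact_subtype_ker_map p
    have syzygy := ih (LinearMap.ker p) (extVanishesAt_contravariant_left kernel_injective p_exact
      p_surjective (extVanishesAt_succ_of_projective n) h)
    exact extVanishesAt_covariant_left (map_injective θ p_surjective)
      (map_exact θ p_exact p_surjective) (map_surjective θ kernel_injective) syzygy
      (extVanishesAt_succ_of_injective (injective_of_projective θ) (n + 1))

end Ext

section Torsion

variable {e : R} {e' : S} {M : Type u} [AddCommGroup M] [Module K M] [Module R M]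
  [IsScalarTower K R M]

theorem torsionFree_of_span_eq_top (he : θ e = op e')
    (hM : Submodule.span R (Set.range fun x : M => e • x) = ⊤) :
    TorsionFree e' (DualMod θ M) := by
  intro φ hφ
  have vanishes : ∀ x ∈ Submodule.span R (Set.range fun x : M => e • x), ∀ r : R,
      φ.toDual (r • x) = 0 := fun x hx => by
    induction hx using Submodule.span_induction with
    | mem x hx =>
      obtain ⟨x, rfl⟩ := hx
      intro r
      have := congrArg (toDual · x) (hφ (θ r).unop)
      rw [smul_toDual, op_mul, op_unop, ← he, ← map_mul, AlgEquiv.symm_apply_apply,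
        mul_smul] at this
      exact this
    | zero => simp
    | add x y _ _ hx hy => simp [hx, hy]
    | smul s x _ hx => exact fun r => smul_smul r s x ▸ hx (r * s)
  refine ext fun x => ?_
  rw [← one_smul R x]
  exact vanishes x (hM.ge Submodule.mem_top) 1

theorem span_range_smul_eq_top [FiniteDimensional K M] (he : θ e = op e')
    (hM : TorsionFree e M) :
    Submodule.span S (Set.range fun φ : DualMod θ M => e' • φ) = ⊤ := by
  let W : Submodule K (Module.Dual K M) :=
    (Submodule.span S (Set.range fun φ : DualMod θ M => e' • φ)).restrictScalars K
  have W_separates : W.dualCoannihilator = ⊥ := by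
    refine (Submodule.eq_bot_iff _).2 fun x hx => hM x fun r => ?_
    refine (Module.forall_dual_apply_eq_zero_iff K _).1 fun φ => ?_
    let ψ : DualMod θ M := φ
    have mem_span : (θ r).unop • e' • ψ ∈
        Submodule.span S (Set.range fun φ : DualMod θ M => e' • φ) :=
      Submodule.smul_mem _ _ (Submodule.subset_span ⟨ψ, rfl⟩)
    have : ((θ r).unop • e' • ψ).toDual x = 0 :=
      (Submodule.mem_dualCoannihilator x).1 hx _ mem_span
    rwa [smul_toDual, smul_toDual, ← he, op_unop, AlgEquiv.symm_apply_apply,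
      AlgEquiv.symm_apply_apply, smul_smul] at this
  have W_eq_top : W = ⊤ := by
    rw [← Subspace.dualCoannihilator_dualAnnihilator_eq (W := W), W_separates,
      Submodule.dualAnnihilator_bot]
  exact (Submodule.eq_top_iff').2 fun φ => W_eq_top.ge (Submodule.mem_top (x := φ.toDual))

end Torsion

end DualMod

section Corner

variable {θ : R ≃ₐ[K] Sᵐᵒᵖ} {e : R} {e' : S} {l : R →ₗ[K] K} {l' : S →ₗ[K] K}

theorem FaithfulSymmetricCorner.dual (h : FaithfulSymmetricCorner K R e l) (he : θ e = op e')
    (hl : ∀ r, l' (θ r).unop = l r) : FaithfulSymmetricCorner K S e' l' := by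
  let τ : R →ₗ[K] S := (opLinearEquiv K).symm.toLinearMap ∘ₗ θ.toLinearMap
  have exists_eq : ∀ s, ∃ r, τ r = s := fun s => ⟨θ.symm (op s), by simp [τ]⟩
  have τ_mul : ∀ r s, τ r * τ s = τ (s * r) := by simp [τ]
  have τ_eq_zero : ∀ r, τ r = 0 ↔ r = 0 := by simp [τ]
  have l_eq : ∀ r, l' (τ r) = l r := hl
  obtain rfl : τ e = e' := congrArg unop he
  constructor
  · exact (τ_mul e e).trans (congrArg τ h.idem)
  · intro a
    obtain ⟨a, rfl⟩ := exists_eq a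
    rw [τ_mul, l_eq, l_eq, h.map_e_mul]
  · intro x y
    obtain ⟨x, rfl⟩ := exists_eq x
    obtain ⟨y, rfl⟩ := exists_eq y
    rw [τ_mul, τ_mul, τ_mul, τ_mul, l_eq, l_eq, ← mul_assoc, ← mul_assoc, h.symm]
  · intro x hx
    obtain ⟨x, rfl⟩ := exists_eq x
    rw [τ_mul, τ_mul, τ_eq_zero, ← mul_assoc]
    refine h.nondegenerate x fun r => ?_
    have := hx (τ r)
    rw [τ_mul, τ_mul, τ_mul, l_eq, mul_assoc, h.map_e_mul, ← h.symm] at this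
    rwa [← mul_assoc, h.map_mul_e, ← mul_assoc]
  · intro a ha
    obtain ⟨a, rfl⟩ := exists_eq a
    refine (τ_eq_zero a).2 (h.faithful_right a fun b => ?_)
    have := ha (τ b)
    rwa [τ_mul, τ_mul, τ_eq_zero, ← mul_assoc] at this
  · intro a ha
    obtain ⟨a, rfl⟩ := exists_eq a
    refine (τ_eq_zero a).2 (h.faithful_left a fun b => ?_)
    have := ha (τ b)
    rwa [τ_mul, τ_mul, τ_eq_zero, ← mul_assoc] at this

theorem DoubleCentralizer.dual (h : DoubleCentralizer e l) (he : θ e = op e')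
    (hl : ∀ r, l' (θ r).unop = l r) : DoubleCentralizer e' l' := by
  intro B B_left B_right B_balanced
  let τ : R →ₗ[K] S := (opLinearEquiv K).symm.toLinearMap ∘ₗ θ.toLinearMap
  have τ_surjective : ∀ s, ∃ r, τ r = s := fun s => ⟨θ.symm (op s), by simp [τ]⟩
  have τ_mul : ∀ r s, τ (r * s) = τ s * τ r := by simp [τ]
  have l_eq : ∀ r, l' (τ r) = l r := hl
  obtain rfl : τ e = e' := congrArg unop he
  obtain ⟨a, ha⟩ := h (B.compl₁₂ τ τ).flip
    (fun y r => by simp [τ_mul, B_right]) (fun y r => by simp [τ_mul, B_left])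
    (fun x y r => by simp [τ_mul, ← mul_assoc, B_balanced])
  refine ⟨τ a, fun y r => ?_⟩
  obtain ⟨r, rfl⟩ := τ_surjective r
  obtain ⟨y, rfl⟩ := τ_surjective y
  rw [← τ_mul, ← τ_mul, l_eq, ← mul_assoc]
  exact ha r y

end Corner

end Duality

/-! ### The depth criterion through `Ext(DR, N)` -/

section Criterion

theorem torsionFree_of_forall_quotient_range_eq_zero {R : Type u} [Ring R] {e : R} {Y C : Type*}
    [AddCommGroup Y] [Module R Y] [AddCommGroup C] [Module R C]
    (hY : Submodule.span R (Set.range fun y : Y => e • y) = ⊤) (ε : Y →ₗ[R] R)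
    (hC : ∀ f : (R ⧸ LinearMap.range ε) →ₗ[R] C, f = 0) : TorsionFree e C := by
  intro x hx
  have vanishes : LinearMap.toSpanSingleton R C x ∘ₗ ε = 0 := by
    refine LinearMap.ext_on_range hY fun y => ?_
    simpa [smul_smul] using hx (ε y)
  have := LinearMap.congr_fun (hC ((LinearMap.range ε).liftQ (LinearMap.toSpanSingleton R C x)
    (LinearMap.range_le_ker_iff.2 vanishes))) ((LinearMap.range ε).mkQ 1)
  simpa using this

theorem HasDepthGE.extVanishesAt_quotient_range {R : Type u} [Ring R] {e : R} {Y N : Type u}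
    [AddCommGroup Y] [Module R Y] [AddCommGroup N] [Module R N] {k : ℕ}
    (hN : HasDepthGE e N (k + 1)) {ε : Y →ₗ[R] R} (hε : ∀ y, ε y = 0 → e • y = 0)
    (hY : ExtVanishesAt R Y N (k + 1)) : ExtVanishesAt R (R ⧸ LinearMap.range ε) N (k + 2) := by
  have kernel : ExtVanishesAt R (LinearMap.ker ε) N k :=
    hN (ModuleCat.of R (LinearMap.ker ε)) (fun y => Subtype.ext (hε y y.2)) k k.lt_succ_self
  have range : ExtVanishesAt R (LinearMap.range ε) N (k + 1) :=
    extVanishesAt_contravariant_right (f := (LinearMap.ker ε).subtype) (g := ε.rangeRestrict)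
      (Submodule.subtype_injective _) (LinearMap.exact_iff.2 (by simp))
      ε.surjective_rangeRestrict kernel hY
  exact extVanishesAt_contravariant_right (Submodule.subtype_injective _)
    (LinearMap.exact_subtype_mkQ _) (Submodule.mkQ_surjective _) range
    (extVanishesAt_succ_of_projective (k + 1))

instance {R : Type u} [Ring R] (e : R) : Module.Finite R (leftIdeal R e) :=
  Module.Finite.of_surjective ((LinearMap.toSpanSingleton R R e).codRestrict _ fun x => ⟨x, rfl⟩)
    (by rintro ⟨_, a, rfl⟩; exact ⟨a, rfl⟩)

namespace FaithfulSymmetricCorner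

variable {K : Type u} [Field K] {R S : Type u} [Ring R] [Algebra K R] [Ring S] [Algebra K S]
  {e : R} {l : R →ₗ[K] K} {e' : S} {l' : S →ₗ[K] K}

theorem eq_of_forall_map_eq (h : FaithfulSymmetricCorner K R e l) {a b : R}
    (hab : ∀ y r, l (y * a * r) = l (y * b * r)) : a = b := by
  refine h.torsionFree_self.eq_of_forall_smul_eq fun y => ?_
  rw [smul_eq_mul, smul_eq_mul, mul_assoc, mul_assoc, ← sub_eq_zero, ← mul_sub]
  refine h.e_mul_eq_zero fun r => ?_
  rw [sub_mul, map_sub, hab, sub_self]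

theorem exists_cogenerator_map (h : FaithfulSymmetricCorner K R e l)
    (hD : DoubleCentralizer e l) (θ : R ≃ₐ[K] Sᵐᵒᵖ) :
    ∃ ε : DualMod (antiSymm θ) S →ₗ[R] R,
      ∀ f y r, f.toDual (θ (r * e * y)).unop = l (y * ε f * r) := by
  have exists_eq : ∀ f : DualMod (antiSymm θ) S, ∃ a, ∀ y r,
      f.toDual (θ (r * e * y)).unop = l (y * a * r) := fun f =>
    hD (LinearMap.mk₂ K (fun y r => f.toDual (θ (r * e * y)).unop)
      (by simp [mul_add]) (by simp) (by simp [add_mul]) (by simp))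
      (fun y r => by
        rw [LinearMap.mk₂_apply, LinearMap.mk₂_apply, ← mul_assoc, mul_assoc r, h.idem.eq])
      (fun y r => by rw [LinearMap.mk₂_apply, LinearMap.mk₂_apply, mul_assoc r, h.idem.eq])
      (by simp [mul_assoc])
  choose F hF using exists_eq
  refine ⟨⟨⟨F, fun f g => h.eq_of_forall_map_eq fun y r => ?_⟩,
    fun s f => h.eq_of_forall_map_eq fun y r => ?_⟩, hF⟩
  · rw [← hF, mul_add, add_mul, map_add, ← hF, ← hF]
    rfl
  · rw [← hF, RingHom.id_apply, smul_eq_mul, ← mul_assoc, ← hF, ← mul_assoc, map_mul θ _ s]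
    rfl

theorem exists_cogenerator_map_smul_eq_zero (h : FaithfulSymmetricCorner K R e l)
    (hD : DoubleCentralizer e l) (θ : R ≃ₐ[K] Sᵐᵒᵖ) :
    ∃ ε : DualMod (antiSymm θ) S →ₗ[R] R,
      (∀ f, ε f = 0 → e • f = 0) ∧ ∀ b, e * b ∈ LinearMap.range ε := by
  obtain ⟨ε, hε⟩ := h.exists_cogenerator_map hD θ
  refine ⟨ε, fun f hf => DualMod.ext fun s => ?_, fun b => ?_⟩
  · have := hε f 1 (θ.symm (op s))
    rw [hf, mul_zero, zero_mul, map_zero, mul_one, map_mul, AlgEquiv.apply_symm_apply] at this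
    exact this
  · let f : DualMod (antiSymm θ) S := l ∘ₗ LinearMap.mulLeft K (e * b) ∘ₗ
      θ.symm.toLinearMap ∘ₗ (opLinearEquiv K).toLinearMap
    refine ⟨f, h.eq_of_forall_map_eq fun y r => ?_⟩
    calc l (y * ε f * r) = l (e * b * θ.symm (θ (r * e * y))) := (hε f y r).symm
      _ = l (y * (e * b) * r) := by
        rw [AlgEquiv.symm_apply_apply, mul_assoc e, h.map_e_mul, ← mul_assoc, ← mul_assoc, h.symm]
        simp only [mul_assoc]

variable [FiniteDimensional K R]

theorem hasDepthGE_succ_of_extVanishesAt (h : FaithfulSymmetricCorner K R e l)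
    {T : Type u} [AddCommGroup T] [Module R T] (heT : ∀ t : T, e • t = 0)
    (hT : ∀ C : ModuleCat.{u} R, (∀ f : T →ₗ[R] C, f = 0) → TorsionFree e C) (n : ℕ)
    (N : Type u) [AddCommGroup N] [Module R N] [Module.Finite R N] (hN : HasDepthGE e N n)
    (hx : ExtVanishesAt R T N n) : HasDepthGE e N (n + 1) := by
  induction n generalizing N with
  | zero => exact hasDepthGE_one_iff.2 (hT (ModuleCat.of R N) (extVanishesAt_zero_iff.1 hx))
  | succ n ih =>
    obtain ⟨m, f, hf, hC⟩ := h.exists_cosyzygy hN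
    have cosyzygy_vanishes := extVanishesAt_covariant_right hf (exact_mkQ_range f)
      (Submodule.mkQ_surjective _)
      (h.hasDepthGE_pi_leftIdeal m (n + 1) (ModuleCat.of R T) heT n n.lt_succ_self) hx
    exact (ih _ hC cosyzygy_vanishes).of_cosyzygy (h.hasDepthGE_pi_leftIdeal m (n + 2)) hf
      (exact_mkQ_range f) (Submodule.mkQ_surjective _)

theorem hasDepthGE_add_three (h : FaithfulSymmetricCorner K R e l) [FiniteDimensional K S]
    (hD : DoubleCentralizer e l) {θ : R ≃ₐ[K] Sᵐᵒᵖ} (he : θ e = op e') (hS : TorsionFree e' S)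
    {N : Type u} [AddCommGroup N] [Module R N] [Module.Finite R N] {k : ℕ}
    (hN : HasDepthGE e N (k + 2)) (hx : ExtVanishesAt R (DualMod (antiSymm θ) S) N (k + 1)) :
    HasDepthGE e N (k + 3) := by
  obtain ⟨ε, ker_killed, mem_range⟩ := h.exists_cogenerator_map_smul_eq_zero hD θ
  have generated : Submodule.span R
      (Set.range fun f : DualMod (antiSymm θ) S => e • f) = ⊤ :=
    DualMod.span_range_smul_eq_top (antiSymm θ)
      (by rw [antiSymm_apply, ← he, AlgEquiv.symm_apply_apply]) hS
  refine h.hasDepthGE_succ_of_extVanishesAt (T := R ⧸ LinearMap.range ε) (fun t => ?_)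
    (fun C hC => torsionFree_of_forall_quotient_range_eq_zero generated ε hC) (k + 2) N hN
    ((hN.mono (Nat.le_succ _)).extVanishesAt_quotient_range ker_killed hx)
  obtain ⟨b, rfl⟩ := Submodule.mkQ_surjective _ t
  exact (Submodule.Quotient.mk_eq_zero _).2 (mem_range b)

theorem hasDepthGE_of_extVanishesAt (h : FaithfulSymmetricCorner K R e l) [FiniteDimensional K S]
    (hR : HasDepthGE e R 2) {θ : R ≃ₐ[K] Sᵐᵒᵖ} (he : θ e = op e') (hS : TorsionFree e' S)
    {N : Type u} [AddCommGroup N] [Module R N] [Module.Finite R N] (hN : HasDepthGE e N 2)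
    (hx : ∀ i, ExtVanishesAt R (DualMod (antiSymm θ) S) N (i + 1)) (n : ℕ) :
    HasDepthGE e N n := by
  suffices H : ∀ k, HasDepthGE e N (k + 2) from (H n).mono (Nat.le_add_right n 2)
  intro k
  induction k with
  | zero => exact hN
  | succ k ih => exact h.hasDepthGE_add_three (h.doubleCentralizer_of_hasDepthGE hR) he hS ih (hx k)

theorem extVanishesAt_of_hasDepthGE (h : FaithfulSymmetricCorner K R e l) {g : ℕ}
    {U : Type u} [AddCommGroup U] [Module R U] (hU : HasInjectiveDimensionLE (ModuleCat.of R U) g)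
    (k : ℕ) (N : Type u) [AddCommGroup N] [Module R N] [Module.Finite R N]
    (hN : HasDepthGE e N k) (j : ℕ) (hj : g < j + 1 + k) : ExtVanishesAt R N U (j + 1) := by
  induction k generalizing N j with
  | zero => exact extVanishesAt_of_hasInjectiveDimensionLE hU hj
  | succ k ih =>
    obtain ⟨m, f, hf, hC⟩ := h.exists_cosyzygy hN
    have := h.projective_pi_leftIdeal m
    exact extVanishesAt_contravariant_left hf (exact_mkQ_range f) (Submodule.mkQ_surjective _)
      (extVanishesAt_succ_of_projective j) (ih _ hC (j + 1) (by omega))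

end FaithfulSymmetricCorner

section Balance

variable {K : Type u} [Field K] {R S : Type u} [Ring R] [Algebra K R] [Ring S] [Algebra K S]
  {e : R} {l : R →ₗ[K] K} {e' : S} {l' : S →ₗ[K] K} {θ : R ≃ₐ[K] Sᵐᵒᵖ}

namespace FaithfulSymmetricCorner

theorem span_range_smul_pi_leftIdeal (h : FaithfulSymmetricCorner K R e l) (m : ℕ) :
    Submodule.span R (Set.range fun z : Fin m → leftIdeal R e => e • z) = ⊤ := by
  refine Submodule.eq_top_iff'.2 fun z => ?_
  rw [← Finset.univ_sum_single z]
  refine Submodule.sum_mem _ fun j _ => ?_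
  let e_mem : leftIdeal R e := ⟨e, 1, (one_mul e).symm⟩
  have : (z j : R) • e • (Pi.single j e_mem : Fin m → leftIdeal R e) = Pi.single j (z j) := by
    rw [← Pi.single_smul, ← Pi.single_smul]
    refine congrArg _ (Subtype.ext ?_)
    change (z j : R) * (e * e) = z j
    rw [h.idem.eq, h.mul_e_of_mem]
  exact this ▸ Submodule.smul_mem _ _ (Submodule.subset_span ⟨_, rfl⟩)

theorem hasDepthGE_dualMod_pi_leftIdeal (h : FaithfulSymmetricCorner K R e l)
    (he : θ e = op e') (m n : ℕ) : HasDepthGE e' (DualMod θ (Fin m → leftIdeal R e)) n :=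
  have := h.projective_pi_leftIdeal m
  (DualMod.torsionFree_of_span_eq_top θ he
    (h.span_range_smul_pi_leftIdeal m)).hasDepthGE_of_injective
      (DualMod.injective_of_projective θ) n

variable [FiniteDimensional K R] [FiniteDimensional K S] {M : Type u} [AddCommGroup M]
  [Module K M] [Module R M] [IsScalarTower K R M] [FiniteDimensional K M]

theorem hasDepthGE_of_hasDepthGE_dualMod (h : FaithfulSymmetricCorner K R e l)
    (h' : FaithfulSymmetricCorner K S e' l') (he : θ e = op e') (hR : HasDepthGE e R 2)
    {g : ℕ} (hg : 2 ≤ g) (hgS : HasInjectiveDimensionLE (ModuleCat.of S S) g)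
    (hM : HasDepthGE e M g) (hDM : HasDepthGE e' (DualMod θ M) g) (n : ℕ) :
    HasDepthGE e M n := by
  have : Module.Finite R M := Module.Finite.of_restrictScalars_finite K R M
  have : Module.Finite S (DualMod θ M) := Module.Finite.of_restrictScalars_finite K S _
  refine h.hasDepthGE_of_extVanishesAt hR he h'.torsionFree_self (hM.mono hg) (fun i => ?_) n
  have ext_dual := h'.extVanishesAt_of_hasDepthGE hgS g (DualMod θ M) hDM i (by omega)
  exact (DualMod.extVanishesAt_succ_dual (antiSymm θ) i _ ext_dual).of_linearEquiv
    (LinearEquiv.refl _ _) (DualMod.evalEquiv θ M).symm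

theorem hasDepthGE_and_hasDepthGE_dualMod (h : FaithfulSymmetricCorner K R e l)
    (h' : FaithfulSymmetricCorner K S e' l') (he : θ e = op e') (hR : HasDepthGE e R 2)
    (hS : HasDepthGE e' S 2) {g : ℕ} (hg : 2 ≤ g)
    (hgR : HasInjectiveDimensionLE (ModuleCat.of R R) g)
    (hgS : HasInjectiveDimensionLE (ModuleCat.of S S) g)
    (hM : HasDepthGE e M g) (hDM : HasDepthGE e' (DualMod θ M) g) (n : ℕ) :
    HasDepthGE e M n ∧ HasDepthGE e' (DualMod θ M) n :=
  ⟨h.hasDepthGE_of_hasDepthGE_dualMod h' he hR hg hgS hM hDM n,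
    h'.hasDepthGE_of_hasDepthGE_dualMod (θ := antiSymm θ) h
      (by rw [antiSymm_apply, ← he, AlgEquiv.symm_apply_apply]) hS hg hgR hDM
      (hM.of_linearEquiv (DualMod.evalEquiv θ M)) n⟩

theorem hasDepthGE_and_hasDepthGE_dualMod_of_le_add (h : FaithfulSymmetricCorner K R e l)
    (h' : FaithfulSymmetricCorner K S e' l') (he : θ e = op e') (hR : HasDepthGE e R 2)
    (hS : HasDepthGE e' S 2) {g : ℕ} (hg : 2 ≤ g)
    (hgR : HasInjectiveDimensionLE (ModuleCat.of R R) g)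
    (hgS : HasInjectiveDimensionLE (ModuleCat.of S S) g) (k b : ℕ) (hb : g ≤ b + k)
    (M : Type u) [AddCommGroup M] [Module K M] [Module R M] [IsScalarTower K R M]
    [FiniteDimensional K M] (hM : HasDepthGE e M (g + k)) (hDM : HasDepthGE e' (DualMod θ M) b)
    (n : ℕ) : HasDepthGE e M n ∧ HasDepthGE e' (DualMod θ M) n := by
  induction k generalizing b M n with
  | zero => exact h.hasDepthGE_and_hasDepthGE_dualMod h' he hR hS hg hgR hgS hM (hDM.mono hb) n
  | succ k ih =>
    have : Module.Finite R M := Module.Finite.of_restrictScalars_finite K R M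
    obtain ⟨m, f, hf, hC⟩ := h.exists_cosyzygy (n := g + k) hM
    have f_exact := exact_mkQ_range f
    have mkQ_surjective := Submodule.mkQ_surjective (LinearMap.range f)
    have dual_injective := DualMod.map_injective θ mkQ_surjective
    have dual_exact := DualMod.map_exact θ f_exact mkQ_surjective
    have dual_surjective := DualMod.map_surjective θ hf
    have hDC := hDM.of_cosyzygy (h.hasDepthGE_dualMod_pi_leftIdeal he m (b + 1)) dual_injective
      dual_exact dual_surjective
    have all_depths := ih (b + 1) (by omega) _ hC hDC
    exact ⟨((all_depths n).1.of_cosyzygy (h.hasDepthGE_pi_leftIdeal m (n + 1)) hf f_exact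
        mkQ_surjective).mono n.le_succ,
      (all_depths (n + 1)).2.cosyzygy (h.hasDepthGE_dualMod_pi_leftIdeal he m n) dual_injective
        dual_exact dual_surjective⟩

end FaithfulSymmetricCorner

end Balance

end Criterion

/-! ### Minimal resolutions and dominant dimension -/

section Minimal

variable {R : Type u} [Ring R] {F : Type u} [AddCommGroup F] [Module R F]
  {p : Submonoid (Module.End R F)} {f h : Module.End R F}

/- As `f * h * f` lies in `p`, minimality forces `f * h` to map the range of `f` onto itself, hence
injectively by the Hopfian property of Noetherian modules. -/
theorem eq_zero_of_minimalFor_range [IsNoetherian R F]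
    (hf : MinimalFor (· ∈ p) LinearMap.range f) (hh : h ∈ p) {x : F}
    (hx : x ∈ LinearMap.range f) (hfx : f (h x) = 0) : x = 0 := by
  have hle : LinearMap.range f ≤ LinearMap.range (f * h * f) :=
    hf.2 (p.mul_mem (p.mul_mem hf.1 hh) hf.1) <| by
      rintro _ ⟨y, rfl⟩
      exact ⟨h (f y), rfl⟩
  let E : LinearMap.range f →ₗ[R] LinearMap.range f := (f.rangeRestrict ∘ₗ h).domRestrict _
  have hE : Function.Injective E := by
    refine IsNoetherian.injective_of_surjective_endomorphism E ?_
    rintro ⟨y, hy⟩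
    obtain ⟨z, rfl⟩ := hle hy
    exact ⟨⟨f z, z, rfl⟩, rfl⟩
  have hx0 : (⟨x, hx⟩ : LinearMap.range f) = 0 := hE ((Subtype.ext hfx).trans (map_zero E).symm)
  exact congrArg Subtype.val hx0

theorem exists_retraction_of_minimalFor_range [IsNoetherian R F] [IsArtinian R F]
    (hf : MinimalFor (· ∈ p) LinearMap.range f) :
    ∃ r : F →ₗ[R] LinearMap.range f, r ∘ₗ (LinearMap.range f).subtype = LinearMap.id := by
  let E : LinearMap.range f →ₗ[R] LinearMap.range f := f.rangeRestrict.domRestrict _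
  have hE : Function.Injective E := (injective_iff_map_eq_zero E).2 fun x hx =>
    Subtype.ext (eq_zero_of_minimalFor_range hf p.one_mem x.2 (congrArg Subtype.val hx))
  let E' := LinearEquiv.ofBijective E ⟨hE, IsArtinian.surjective_of_injective_endomorphism E hE⟩
  exact ⟨E'.symm.toLinearMap ∘ₗ f.rangeRestrict, LinearMap.ext fun x => E'.symm_apply_apply x⟩

theorem injective_of_retract {I : Type u} [AddCommGroup I] [Module R I] (hF : Module.Injective R F)
    (i : I →ₗ[R] F) (r : F →ₗ[R] I) (h : r ∘ₗ i = LinearMap.id) : Module.Injective R I := by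
  refine ⟨fun X Y _ _ _ _ f hf g => ?_⟩
  obtain ⟨k, hk⟩ := hF.out f hf (i ∘ₗ g)
  exact ⟨r ∘ₗ k, fun x => by simpa [hk] using LinearMap.congr_fun h (g x)⟩

variable {M : Type u} [AddCommGroup M] [Module R M]

/-- The endomorphisms of `F` under `j : M → F`, whose minimal ranges are the injective hulls of
`M` if `F` is injective. -/
def endUnder (j : M →ₗ[R] F) : Submonoid (Module.End R F) where
  carrier := {f | f ∘ₗ j = j}
  one_mem' := rfl
  mul_mem' {f g} hf hg := by
    change _ = _ at hf hg ⊢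
    rw [Module.End.mul_eq_comp, LinearMap.comp_assoc, hg, hf]

/-- The endomorphisms of `F` over `q : F → M`, whose minimal ranges are the projective covers of
`M` if `F` is projective. -/
def endOver (q : F →ₗ[R] M) : Submonoid (Module.End R F) where
  carrier := {f | q ∘ₗ f = q}
  one_mem' := rfl
  mul_mem' {f g} hf hg := by
    change _ = _ at hf hg ⊢
    rw [Module.End.mul_eq_comp, ← LinearMap.comp_assoc, hf, hg]

theorem isEssential_range_codRestrict_of_minimalFor [IsNoetherian R F] (hF : Module.Injective R F)
    {j : M →ₗ[R] F} (hj : Function.Injective j)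
    (hf : MinimalFor (· ∈ endUnder j) LinearMap.range f) (hfj : ∀ x, j x ∈ LinearMap.range f) :
    IsEssential (LinearMap.range (j.codRestrict (LinearMap.range f) hfj)) := by
  intro L hL
  let L' : Submodule R F := L.map (LinearMap.range f).subtype
  have hinj : Function.Injective (L'.mkQ ∘ₗ j) := (injective_iff_map_eq_zero _).2 fun x hx => by
    obtain ⟨y, hy, hyx⟩ : j x ∈ L' := (Submodule.Quotient.mk_eq_zero _).1 hx
    have hy0 : y ∈ LinearMap.range (j.codRestrict (LinearMap.range f) hfj) ⊓ L :=
      ⟨⟨x, Subtype.ext hyx.symm⟩, hy⟩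
    rw [hL, Submodule.mem_bot] at hy0
    apply hj
    rw [map_zero, ← hyx, hy0, map_zero]
  obtain ⟨h, hh⟩ := hF.out _ hinj j
  refine (Submodule.eq_bot_iff _).2 fun x hx => Subtype.ext ?_
  refine eq_zero_of_minimalFor_range hf (h := h ∘ₗ L'.mkQ) (LinearMap.ext hh) x.2 ?_
  have hx0 : L'.mkQ x = 0 := (Submodule.Quotient.mk_eq_zero _).2 ⟨x, hx, rfl⟩
  rw [LinearMap.comp_apply, hx0, map_zero, map_zero]

theorem isSuperfluous_ker_comp_subtype_of_minimalFor [Module.Projective R F] {q : F →ₗ[R] M}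
    (hq : Function.Surjective q) (hf : MinimalFor (· ∈ endOver q) LinearMap.range f) :
    IsSuperfluous (LinearMap.ker (q ∘ₗ (LinearMap.range f).subtype)) := by
  intro L hL
  have hs : Function.Surjective (q ∘ₗ (LinearMap.range f).subtype ∘ₗ L.subtype) := fun y => by
    obtain ⟨x, rfl⟩ := hq y
    obtain ⟨a, ha, b, hb, hab⟩ := Submodule.mem_sup.1
      (hL.ge (Submodule.mem_top (x := (⟨f x, x, rfl⟩ : LinearMap.range f))))
    have hqa : q (a : F) = 0 := ha
    have hfx : (a : F) + b = f x := congrArg Subtype.val hab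
    refine ⟨⟨b, hb⟩, ?_⟩
    calc q b = q (f x) := by rw [← hfx, map_add, hqa, zero_add]
      _ = q x := LinearMap.congr_fun hf.1 x
  obtain ⟨h, hh⟩ := Module.projective_lifting_property _ q hs
  have hle := hf.2 (j := (LinearMap.range f).subtype ∘ₗ L.subtype ∘ₗ h) hh <| by
    rintro _ ⟨x, rfl⟩
    exact (h x).1.2
  refine eq_top_iff.2 fun x _ => ?_
  obtain ⟨y, hy⟩ := hle x.2
  have hyx : (h y).1 = x := Subtype.ext hy
  exact hyx ▸ (h y).2

end Minimal

section Hulls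

variable {R : Type u} [Ring R]

theorem exists_finite_injective_embedding (K : Type u) [Field K] [Algebra K R]
    [FiniteDimensional K R] (M : Type u) [AddCommGroup M] [Module R M] [Module.Finite R M] :
    ∃ (F : ModuleCat.{u} R) (f : M →ₗ[R] F), Module.Finite R F ∧
      Module.Injective R F ∧ Function.Injective f := by
  let _ : Module K M := Module.compHom M (algebraMap K R)
  have : IsScalarTower K R M := IsScalarTower.of_algebraMap_smul fun _ _ => rfl
  have : Module.Finite K M := Module.Finite.trans R M
  let θ : R ≃ₐ[K] Rᵐᵒᵖᵐᵒᵖ := AlgEquiv.opOp K R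
  have : Module.Finite Rᵐᵒᵖ (DualMod θ M) := Module.Finite.of_restrictScalars_finite K _ _
  obtain ⟨n, q, hq⟩ := Module.Finite.exists_fin' Rᵐᵒᵖ (DualMod θ M)
  exact ⟨ModuleCat.of R (DualMod (antiSymm θ) (Fin n → Rᵐᵒᵖ)),
    DualMod.map (antiSymm θ) q ∘ₗ (DualMod.evalEquiv θ M).toLinearMap,
    Module.Finite.of_restrictScalars_finite K R (DualMod (antiSymm θ) (Fin n → Rᵐᵒᵖ)),
    DualMod.injective_of_projective (antiSymm θ),
    (DualMod.map_injective (antiSymm θ) hq).comp (DualMod.evalEquiv θ M).injective⟩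

theorem exists_injective_hull (K : Type u) [Field K] [Algebra K R] [FiniteDimensional K R]
    (M : Type u) [AddCommGroup M] [Module R M] [Module.Finite R M] :
    ∃ (I : ModuleCat.{u} R) (ι : M →ₗ[R] I), Module.Finite R I ∧
      Module.Injective R I ∧ Function.Injective ι ∧ IsEssential (LinearMap.range ι) := by
  have := IsNoetherianRing.of_finite K R
  have := IsArtinianRing.of_finite K R
  obtain ⟨F, j, _, hF, hj⟩ := exists_finite_injective_embedding K M (R := R)
  obtain ⟨f, hf⟩ := exists_minimalFor_of_wellFoundedLT (· ∈ endUnder j) LinearMap.range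
    ⟨1, (endUnder j).one_mem⟩
  obtain ⟨r, hr⟩ := exists_retraction_of_minimalFor_range hf
  have hfj : ∀ x, j x ∈ LinearMap.range f := fun x => ⟨j x, LinearMap.congr_fun hf.1 x⟩
  exact ⟨ModuleCat.of R (LinearMap.range f), j.codRestrict _ hfj,
    inferInstanceAs (Module.Finite R (LinearMap.range f)), injective_of_retract hF _ r hr,
    fun x y hxy => hj (congrArg Subtype.val hxy),
    isEssential_range_codRestrict_of_minimalFor hF hj hf hfj⟩

theorem exists_projective_cover (K : Type u) [Field K] [Algebra K R] [FiniteDimensional K R]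
    (M : Type u) [AddCommGroup M] [Module R M] [Module.Finite R M] :
    ∃ (P : ModuleCat.{u} R) (π : P →ₗ[R] M), Module.Finite R P ∧
      Module.Projective R P ∧ Function.Surjective π ∧ IsSuperfluous (LinearMap.ker π) := by
  have := IsNoetherianRing.of_finite K R
  have := IsArtinianRing.of_finite K R
  obtain ⟨n, q, hq⟩ := Module.Finite.exists_fin' R M
  obtain ⟨f, hf⟩ := exists_minimalFor_of_wellFoundedLT (· ∈ endOver q) LinearMap.range
    ⟨1, (endOver q).one_mem⟩
  obtain ⟨r, hr⟩ := exists_retraction_of_minimalFor_range hf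
  refine ⟨ModuleCat.of R (LinearMap.range f), q ∘ₗ (LinearMap.range f).subtype,
    inferInstanceAs (Module.Finite R (LinearMap.range f)), Module.Projective.of_split _ r hr,
    fun y => ?_, isSuperfluous_ker_comp_subtype_of_minimalFor hq hf⟩
  obtain ⟨x, rfl⟩ := hq y
  exact ⟨⟨f x, x, rfl⟩, LinearMap.congr_fun hf.1 x⟩

theorem exists_minProjPresentation (K : Type u) [Field K] [Algebra K R] [FiniteDimensional K R]
    (M : Type u) [AddCommGroup M] [Module R M] [Module.Finite R M] :
    Nonempty (MinProjPresentation R M) := by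
  have := IsNoetherianRing.of_finite K R
  obtain ⟨P₀, π, hfin₀, hp₀, hπ, hs₀⟩ := exists_projective_cover K M (R := R)
  obtain ⟨P₁, ρ, hfin₁, hp₁, hρ, hs₁⟩ := exists_projective_cover K (LinearMap.ker π) (R := R)
  refine ⟨⟨P₀, P₁, hfin₀, hfin₁, hp₀, hp₁, π, (LinearMap.ker π).subtype ∘ₗ ρ, hπ, ?_, hs₀, ?_⟩⟩
  · rw [LinearMap.exact_iff, LinearMap.range_comp_of_range_eq_top _ (LinearMap.range_eq_top.2 hρ),
      Submodule.range_subtype]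
  · rwa [LinearMap.ker_comp_of_ker_eq_bot _ (Submodule.ker_subtype _)]

theorem exists_minInjResolution (K : Type u) [Field K] [Algebra K R] [FiniteDimensional K R]
    (M : Type u) [AddCommGroup M] [Module R M] [Module.Finite R M] :
    ∃ E : MinInjResolution R M, ∀ n, Module.Finite R (E.I n) := by
  have H : ∀ N : {N : ModuleCat.{u} R // Module.Finite R N}, ∃ (I : ModuleCat.{u} R)
      (ι : N.1 →ₗ[R] I), Module.Finite R I ∧ Module.Injective R I ∧ Function.Injective ι ∧
        IsEssential (LinearMap.range ι) := fun N =>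
    have := N.2
    exists_injective_hull K N.1
  choose I ι hfin hinj hι hess using H
  let cosyzygy : ℕ → {N : ModuleCat.{u} R // Module.Finite R N} := fun n => Nat.rec
    ⟨ModuleCat.of R M, inferInstanceAs (Module.Finite R M)⟩
    (fun _ N => ⟨ModuleCat.of R (I N ⧸ LinearMap.range (ι N)),
      have := hfin N
      inferInstanceAs (Module.Finite R (I N ⧸ LinearMap.range (ι N)))⟩) n
  let d : ∀ n, I (cosyzygy n) →ₗ[R] I (cosyzygy (n + 1)) := fun n =>
    ι (cosyzygy (n + 1)) ∘ₗ (LinearMap.range (ι (cosyzygy n))).mkQ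
  have hker : ∀ n, LinearMap.ker (d n) = LinearMap.range (ι (cosyzygy n)) := fun n =>
    (LinearMap.ker_comp_of_ker_eq_bot _ (LinearMap.ker_eq_bot.2 (hι _))).trans
      (Submodule.ker_mkQ _)
  have hrange : ∀ n, LinearMap.range (d n) = LinearMap.range (ι (cosyzygy (n + 1))) := fun n =>
    LinearMap.range_comp_of_range_eq_top _ (Submodule.range_mkQ _)
  exact ⟨⟨fun n => I (cosyzygy n), fun n => hinj _, ι (cosyzygy 0), d, hι _,
    LinearMap.exact_iff.2 (hker 0),
    fun n => LinearMap.exact_iff.2 ((hker (n + 1)).trans (hrange n).symm), hess _,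
    fun n => (hrange n).symm ▸ hess _⟩, fun _ => hfin _⟩

end Hulls

section DominantDimension

/-- The minimal injective resolution of the first cosyzygy. -/
def MinInjResolution.tail {R : Type u} [Ring R] {M : Type u} [AddCommGroup M] [Module R M]
    (E : MinInjResolution R M) : MinInjResolution R (E.I 0 ⧸ LinearMap.range E.ι) where
  I n := E.I (n + 1)
  injective n := E.injective (n + 1)
  ι := (LinearMap.range E.ι).liftQ (E.d 0) (LinearMap.exact_iff.1 E.exact_zero).ge
  d n := E.d (n + 1)
  ι_injective := LinearMap.ker_eq_bot.1
    (Submodule.ker_liftQ_eq_bot _ _ _ (LinearMap.exact_iff.1 E.exact_zero).le)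
  exact_zero := by
    rw [LinearMap.exact_iff, Submodule.range_liftQ]
    exact LinearMap.exact_iff.1 (E.exact_succ 0)
  exact_succ n := E.exact_succ (n + 1)
  essential_zero := by
    rw [Submodule.range_liftQ]
    exact E.essential_succ 0
  essential_succ n := E.essential_succ (n + 1)

theorem TorsionFree.of_isEssential {R : Type u} [Ring R] {e : R} {M I : Type u} [AddCommGroup M]
    [Module R M] [AddCommGroup I] [Module R I] (h : TorsionFree e M) {ι : M →ₗ[R] I}
    (hinj : Function.Injective ι) (hess : IsEssential (LinearMap.range ι)) : TorsionFree e I := by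
  intro x hx
  have hspan : ∀ y ∈ Submodule.span R {x}, ∀ r : R, (e * r) • y = 0 := by
    intro y hy r
    obtain ⟨s, rfl⟩ := Submodule.mem_span_singleton.1 hy
    rw [smul_smul, mul_assoc]
    exact hx _
  refine Submodule.span_singleton_eq_bot.1 (hess _ ((Submodule.eq_bot_iff _).2 ?_))
  rintro _ ⟨⟨m, rfl⟩, hm⟩
  rw [h m fun r => hinj (by rw [map_smul, hspan _ hm, map_zero]), map_zero]

theorem torsionFree_of_minInjResolution {R : Type u} [Ring R] {e : R} {n : ℕ} : ∀ {M : Type u}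
    [AddCommGroup M] [Module R M] (E : MinInjResolution R M), HasDepthGE e M n →
    ∀ i < n, TorsionFree e (E.I i) := by
  induction n with
  | zero => exact fun _ _ _ hi => absurd hi (Nat.not_lt_zero _)
  | succ n ih =>
    intro M _ _ E hM i hi
    have hI₀ : TorsionFree e (E.I 0) := hM.torsionFree.of_isEssential E.ι_injective E.essential_zero
    rcases i with _ | i
    · exact hI₀
    · exact ih E.tail (hM.cosyzygy (hI₀.hasDepthGE_of_injective (E.injective 0) n) E.ι_injective
        (exact_mkQ_range _) (Submodule.mkQ_surjective _)) i (Nat.lt_of_succ_lt_succ hi)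

namespace FaithfulSymmetricCorner

variable {K : Type u} [Field K] {R : Type u} [Ring R] [Algebra K R] {e : R} {l : R →ₗ[K] K}

theorem hasDepthGE_of_minInjResolution (h : FaithfulSymmetricCorner K R e l) {n : ℕ} :
    ∀ {M : Type u} [AddCommGroup M] [Module R M] (E : MinInjResolution R M),
      (∀ i < n, Module.Projective R (E.I i)) → HasDepthGE e M n := by
  induction n with
  | zero => exact fun _ _ => hasDepthGE_zero
  | succ n ih =>
    intro M _ _ E hE
    have := hE 0 n.succ_pos
    exact (ih E.tail fun i hi => hE (i + 1) (Nat.succ_lt_succ hi)).of_cosyzygy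
      (h.torsionFree_of_projective.hasDepthGE_of_injective (E.injective 0) _)
      E.ι_injective (exact_mkQ_range _) (Submodule.mkQ_surjective _)

theorem le_domdim_iff (h : FaithfulSymmetricCorner K R e l) [FiniteDimensional K R] {M : Type u}
    [AddCommGroup M] [Module R M] [Module.Finite R M] (n : ℕ) :
    (n : ℕ∞) ≤ domdim R M ↔ HasDepthGE e M n := by
  constructor
  · intro hn
    rcases n with _ | n
    · exact hasDepthGE_zero
    · have hlt : (n : ℕ∞) < domdim R M :=
        (ENat.add_one_le_iff (ENat.natCast_ne_top n)).1 (by exact_mod_cast hn)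
      simp only [domdim, lt_iSup_iff, Nat.cast_lt] at hlt
      obtain ⟨m, ⟨E, hE⟩, hnm⟩ := hlt
      exact h.hasDepthGE_of_minInjResolution E fun i hi => hE i (hi.trans_le hnm)
  · intro hM
    obtain ⟨E, hE⟩ := exists_minInjResolution K M (R := R)
    exact le_iSup₂_of_le n ⟨E, fun i hi =>
      have := hE i
      h.projective_of_injective (E.injective i) (torsionFree_of_minInjResolution E hM i hi)⟩ le_rfl

end FaithfulSymmetricCorner

end DominantDimension

theorem exact_lcomp {R S U M I N : Type*} [Ring R] [Ring S] [AddCommGroup U] [Module R U]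
    [Module S U] [SMulCommClass R S U] [AddCommGroup M] [Module R M] [AddCommGroup I] [Module R I]
    [AddCommGroup N] [Module R N] {f : M →ₗ[R] I} {g : I →ₗ[R] N} (hfg : Function.Exact f g)
    (hg : Function.Surjective g) :
    Function.Exact (LinearMap.lcomp S U g) (LinearMap.lcomp S U f) := fun φ => by
  constructor
  · intro hφ
    have hle : LinearMap.range f ≤ LinearMap.ker φ := by
      rintro _ ⟨x, rfl⟩
      exact LinearMap.congr_fun hφ x
    let E := hfg.linearEquivOfSurjective hg
    refine ⟨(LinearMap.range f).liftQ φ hle ∘ₗ E.symm.toLinearMap, LinearMap.ext fun x => ?_⟩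
    have hx : E.symm (g x) = (LinearMap.range f).mkQ x := E.symm_apply_eq.2 rfl
    simp only [LinearMap.lcomp_apply, LinearMap.comp_apply, LinearEquiv.coe_coe, hx,
      Submodule.mkQ_apply, Submodule.liftQ_apply]
  · rintro ⟨ψ, rfl⟩
    refine LinearMap.ext fun x => ?_
    change ψ (g (f x)) = 0
    rw [hfg.apply_apply_eq_zero, map_zero]

/-! ### Evaluation maps and Gorenstein projective modules -/

section Bimodule

variable {R S U : Type u} [Ring R] [Ring S] [AddCommGroup U] [Module R U] [Module S U]
  [SMulCommClass R S U]

section Evaluation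

variable {P F : Type*} [AddCommGroup P] [Module R P] [AddCommGroup F] [Module R F]

theorem bijective_eval_of_retract {i : P →ₗ[R] F} {q : F →ₗ[R] P} (hqi : q ∘ₗ i = LinearMap.id)
    (hF : Function.Bijective (LinearMap.applyₗ' S : F →+ (F →ₗ[R] U) →ₗ[S] U)) :
    Function.Bijective (LinearMap.applyₗ' S : P →+ (P →ₗ[R] U) →ₗ[S] U) := by
  constructor
  · intro x y hxy
    have hi : i x = i y := hF.1 (LinearMap.ext fun φ => LinearMap.congr_fun hxy (φ ∘ₗ i))
    calc x = q (i x) := (LinearMap.congr_fun hqi x).symm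
      _ = q (i y) := by rw [hi]
      _ = y := LinearMap.congr_fun hqi y
  · intro ξ
    obtain ⟨z, hz⟩ := hF.2 (ξ ∘ₗ LinearMap.lcomp S U i)
    refine ⟨q z, LinearMap.ext fun φ => (LinearMap.congr_fun hz (φ ∘ₗ q)).trans ?_⟩
    change ξ (φ ∘ₗ q ∘ₗ i) = ξ φ
    rw [hqi, LinearMap.comp_id]

theorem bijective_eval_pi (hR : Function.Bijective (Module.toModuleEnd S (S := R) U))
    (ι : Type*) [Finite ι] :
    Function.Bijective (LinearMap.applyₗ' S : (ι → R) →+ ((ι → R) →ₗ[R] U) →ₗ[S] U) := by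
  classical
  have := Fintype.ofFinite ι
  let E := LinearEquiv.piRing R U ι S
  constructor
  · intro x y hxy
    refine funext fun k => hR.1 (LinearMap.ext fun u => ?_)
    have h := LinearMap.congr_fun hxy (LinearMap.toSpanSingleton R U u ∘ₗ LinearMap.proj k)
    exact h
  · intro ξ
    choose r hr using fun k => hR.2 (ξ ∘ₗ E.symm.toLinearMap ∘ₗ LinearMap.single S (fun _ => U) k)
    refine ⟨r, LinearMap.ext fun φ => ?_⟩
    obtain ⟨v, rfl⟩ := E.symm.surjective φ
    calc E.symm v r = ∑ k, r k • v k := LinearEquiv.piRing_symm_apply S v r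
      _ = ∑ k, ξ (E.symm (Pi.single k (v k))) :=
        Finset.sum_congr rfl fun k _ => LinearMap.congr_fun (hr k) (v k)
      _ = ξ (E.symm v) := by rw [← map_sum, ← map_sum, Finset.univ_sum_single]

theorem bijective_eval_of_projective (hR : Function.Bijective (Module.toModuleEnd S (S := R) U))
    [Module.Finite R P] [Module.Projective R P] :
    Function.Bijective (LinearMap.applyₗ' S : P →+ (P →ₗ[R] U) →ₗ[S] U) := by
  obtain ⟨n, q, i, -, -, hqi⟩ := Module.Finite.exists_comp_eq_id_of_projective R P
  exact bijective_eval_of_retract hqi (bijective_eval_pi hR (Fin n))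

variable (R S U P) in
theorem projective_hom [Module.Projective S U] [Module.Finite R P] [Module.Projective R P] :
    Module.Projective S (P →ₗ[R] U) := by
  obtain ⟨n, q, i, -, -, hqi⟩ := Module.Finite.exists_comp_eq_id_of_projective R P
  have : Module.Projective S ((Fin n → R) →ₗ[R] U) :=
    Module.Projective.of_equiv ((DFinsupp.linearEquivFunOnFintype (M := fun _ : Fin n => U)).trans
      (LinearEquiv.piRing R U (Fin n) S).symm)
  refine Module.Projective.of_split (LinearMap.lcomp S U q) (LinearMap.lcomp S U i) ?_
  refine LinearMap.ext fun φ => ?_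
  change φ ∘ₗ q ∘ₗ i = φ
  rw [hqi, LinearMap.comp_id]

end Evaluation

section Transpose

variable {M : Type u} [AddCommGroup M] [Module R M] (p : MinProjPresentation R M)

theorem exact_lcomp_rangeRestrict :
    Function.Exact (LinearMap.lcomp S U p.π) (LinearMap.lcomp S U p.d).rangeRestrict := by
  rw [LinearMap.exact_iff, LinearMap.ker_rangeRestrict, ← LinearMap.exact_iff]
  exact exact_lcomp p.exact p.π_surjective

theorem injective_eval_of_extVanishesAt_transpose
    (hR : Function.Bijective (Module.toModuleEnd S (S := R) U))
    (h : ExtVanishesAt S (Transpose S U p) U 1) :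
    Function.Injective (LinearMap.applyₗ' S : M →+ (M →ₗ[R] U) →ₗ[S] U) := by
  have := p.finite₀
  have := p.finite₁
  have := p.projective₀
  have := p.projective₁
  let δ := LinearMap.lcomp S U p.d
  refine (injective_iff_map_eq_zero _).2 fun x hx => ?_
  obtain ⟨y, rfl⟩ := p.π_surjective x
  have hy₀ : LinearMap.lcomp ℤ U (LinearMap.lcomp S U p.π) (LinearMap.applyₗ' S y) = 0 := hx
  obtain ⟨η, hη⟩ := (exact_lcomp (S := ℤ) (exact_lcomp_rangeRestrict p)
    δ.surjective_rangeRestrict _).1 hy₀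
  obtain ⟨ζ, hζ⟩ := exists_extension_of_extVanishesAt_one
    (Submodule.subtype_injective (LinearMap.range δ)) (LinearMap.exact_subtype_mkQ _)
    (Submodule.mkQ_surjective _) h η
  obtain ⟨z, rfl⟩ := (bijective_eval_of_projective hR).2 ζ
  have hy : y = p.d z := (bijective_eval_of_projective (S := S) hR).1 <| LinearMap.ext fun φ =>
    calc φ y = η (δ.rangeRestrict φ) := (LinearMap.congr_fun hη φ).symm
      _ = φ (p.d z) := (LinearMap.congr_fun hζ (δ.rangeRestrict φ)).symm
  rw [hy, p.exact.apply_apply_eq_zero]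

theorem surjective_eval_of_extVanishesAt_transpose [Module.Projective S U]
    (hR : Function.Bijective (Module.toModuleEnd S (S := R) U))
    (h : ExtVanishesAt S (Transpose S U p) U 2) :
    Function.Surjective (LinearMap.applyₗ' S : M →+ (M →ₗ[R] U) →ₗ[S] U) := by
  have := p.finite₀
  have := p.finite₁
  have := p.projective₀
  have := p.projective₁
  have := projective_hom R S U p.P₁
  let δ := LinearMap.lcomp S U p.d
  have hδ : ExtVanishesAt S (LinearMap.range δ) U 1 :=
    extVanishesAt_contravariant_left (Submodule.subtype_injective (LinearMap.range δ))
      (LinearMap.exact_subtype_mkQ _) (Submodule.mkQ_surjective _)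
      (extVanishesAt_succ_of_projective 0) h
  intro ψ
  obtain ⟨ξ, rfl⟩ := exists_extension_of_extVanishesAt_one
    (LinearMap.lcomp_injective_of_surjective p.π p.π_surjective)
    (exact_lcomp_rangeRestrict p) δ.surjective_rangeRestrict hδ ψ
  obtain ⟨y, rfl⟩ := (bijective_eval_of_projective hR).2 ξ
  exact ⟨p.π y, rfl⟩

theorem IsGProj.bijective_eval [Module.Projective S U]
    (hR : Function.Bijective (Module.toModuleEnd S (S := R) U)) (hM : IsGProj R M S U) :
    Function.Bijective (LinearMap.applyₗ' S : M →+ (M →ₗ[R] U) →ₗ[S] U) := by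
  obtain ⟨-, p, hp⟩ := hM
  exact ⟨injective_eval_of_extVanishesAt_transpose p hR (hp 1 le_rfl),
    surjective_eval_of_extVanishesAt_transpose p hR (hp 2 one_le_two)⟩

/- A map `u` as in the criterion for depth two gives, for each `f : M → U`, such a map `f ∘ u` to
`U`; the elements of `U` representing these maps form a linear form on `Hom(M, U)`, which is the
evaluation at the element representing `u`. -/
theorem HasDepthGE.two_of_bijective_eval {e : R} (hU : HasDepthGE e U 2)
    (hM : Function.Bijective (LinearMap.applyₗ' S : M →+ (M →ₗ[R] U) →ₗ[S] U)) :
    HasDepthGE e M 2 := by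
  have ext_eval : ∀ x y : M, (∀ f : M →ₗ[R] U, f x = f y) → x = y := fun x y hxy =>
    hM.1 (LinearMap.ext hxy)
  have hUe : TorsionFree e U := hU.torsionFree
  refine HasDepthGE.two_of_forall_exists_eq_smul (K := ℤ) (fun x hx => ext_eval _ _ fun f => ?_)
    fun u hu => ?_
  · rw [map_zero]
    exact hUe _ fun r => by rw [← map_smul, hx, map_zero]
  · choose ν hν using fun f : M →ₗ[R] U =>
      hU.exists_eq_smul (f.toAddMonoidHom.comp u.toAddMonoidHom) fun x y =>
        (congrArg f (hu x y)).trans (map_smul f _ _)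
    have hfu : ∀ f y, f (u y) = (e * y) • ν f := hν
    let ψ : (M →ₗ[R] U) →ₗ[S] U :=
      { toFun := ν
        map_add' := fun f f' => hUe.eq_of_forall_smul_eq fun r => by
          rw [smul_add, ← hfu, ← hfu, ← hfu, LinearMap.add_apply]
        map_smul' := fun s f => hUe.eq_of_forall_smul_eq fun r => by
          rw [RingHom.id_apply, smul_comm, ← hfu, ← hfu, LinearMap.smul_apply] }
    obtain ⟨x, hx⟩ := hM.2 ψ
    refine ⟨x, fun y => ext_eval _ _ fun f => ?_⟩
    rw [hfu, map_smul]
    exact congrArg _ (LinearMap.congr_fun hx f).symm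

theorem exact_subtype_range : Function.Exact (LinearMap.range p.d).subtype p.π := by
  rw [LinearMap.exact_iff, Submodule.range_subtype, LinearMap.exact_iff.1 p.exact]

theorem range_lcomp_eq_ker_lcomp (hM : ExtVanishesAt R M U 1) :
    LinearMap.range (LinearMap.lcomp S U p.d) =
      LinearMap.ker (LinearMap.lcomp S U (LinearMap.ker p.d).subtype) := by
  refine le_antisymm ?_ fun φ hφ => ?_
  · rintro _ ⟨φ, rfl⟩
    exact LinearMap.ext fun x => (congrArg φ (LinearMap.mem_ker.1 x.2)).trans (map_zero φ)
  · have hex : Function.Exact (LinearMap.ker p.d).subtype p.d.rangeRestrict := by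
      rw [LinearMap.exact_iff, LinearMap.ker_rangeRestrict, Submodule.range_subtype]
    obtain ⟨ψ, rfl⟩ := (exact_lcomp (S := S) hex p.d.surjective_rangeRestrict φ).1 hφ
    obtain ⟨χ, rfl⟩ := exists_extension_of_extVanishesAt_one (Submodule.subtype_injective _)
      (exact_subtype_range p) p.π_surjective hM ψ
    exact ⟨χ, rfl⟩

variable [IsNoetherianRing R] [Module.Projective S U] {g : ℕ}

/- Dualizing `0 → Z → Rⁿ → X → 0` raises the degree of `Ext` by one when passing from `X` to `Z`, so
the finite injective dimension is reached after finitely many syzygies. -/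
theorem extVanishesAt_hom (hU : HasInjectiveDimensionLE (ModuleCat.of S U) g) (k : ℕ) :
    ∀ (X : Type u) [AddCommGroup X] [Module R X] [Module.Finite R X],
      (∀ i, ExtVanishesAt R X U (i + 1)) →
        ∀ j, g < j + 1 + k → ExtVanishesAt S (X →ₗ[R] U) U (j + 1) := by
  induction k with
  | zero => exact fun X _ _ _ _ j hj => extVanishesAt_of_hasInjectiveDimensionLE hU hj
  | succ k ih =>
    intro X _ _ _ hX j hj
    obtain ⟨n, q, hq⟩ := Module.Finite.exists_fin' R X
    have hi := Submodule.subtype_injective (LinearMap.ker q)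
    have hex := LinearMap.exact_subtype_ker_map q
    have hZ : ∀ i, ExtVanishesAt R (LinearMap.ker q) U (i + 1) := fun i =>
      extVanishesAt_contravariant_left hi hex hq (extVanishesAt_succ_of_projective i) (hX (i + 1))
    have := projective_hom R S U (Fin n → R)
    exact extVanishesAt_contravariant_left (LinearMap.lcomp_injective_of_surjective q hq)
      (exact_lcomp hex hq) (exists_extension_of_extVanishesAt_one hi hex hq (hX 0))
      (extVanishesAt_succ_of_projective j) (ih _ hZ (j + 1) (by omega))

/- The transpose of `M` is the dual of its second syzygy. -/
theorem extVanishesAt_transpose (hU : HasInjectiveDimensionLE (ModuleCat.of S U) g)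
    (hM : ∀ i, ExtVanishesAt R M U (i + 1)) (j : ℕ) :
    ExtVanishesAt S (Transpose S U p) U (j + 1) := by
  have := p.finite₁
  have := p.projective₀
  have := p.projective₁
  have hΩ : ∀ i, ExtVanishesAt R (LinearMap.range p.d) U (i + 1) := fun i =>
    extVanishesAt_contravariant_left (Submodule.subtype_injective _) (exact_subtype_range p)
      p.π_surjective (extVanishesAt_succ_of_projective i) (hM (i + 1))
  have hi := Submodule.subtype_injective (LinearMap.ker p.d)
  have hex : Function.Exact (LinearMap.ker p.d).subtype p.d.rangeRestrict := by
    rw [LinearMap.exact_iff, LinearMap.ker_rangeRestrict, Submodule.range_subtype]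
  have hs := p.d.surjective_rangeRestrict
  have hΩ₂ : ∀ i, ExtVanishesAt R (LinearMap.ker p.d) U (i + 1) := fun i =>
    extVanishesAt_contravariant_left hi hex hs (extVanishesAt_succ_of_projective i) (hΩ (i + 1))
  have hres : Function.Surjective (LinearMap.lcomp S U (LinearMap.ker p.d).subtype) :=
    exists_extension_of_extVanishesAt_one hi hex hs (hΩ 0)
  let E : Transpose S U p ≃ₗ[S] (LinearMap.ker p.d →ₗ[R] U) :=
    (Submodule.quotEquivOfEq _ _ (range_lcomp_eq_ker_lcomp p (hM 0))).trans
      (LinearMap.quotKerEquivOfSurjective _ hres)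
  exact (extVanishesAt_hom hU g (LinearMap.ker p.d) hΩ₂ j (by omega)).of_linearEquiv E.symm
    (LinearEquiv.refl S U)

theorem isGProj_of_extVanishesAt (hU : HasInjectiveDimensionLE (ModuleCat.of S U) g)
    (hM : ∀ i, ExtVanishesAt R M U (i + 1)) (p : MinProjPresentation R M) : IsGProj R M S U :=
  ⟨extVanishes_iff_forall_succ.2 hM, p,
    extVanishes_iff_forall_succ.2 (extVanishesAt_transpose p hU hM)⟩

end Transpose

end Bimodule

section SmallInjectiveDimension

variable {K : Type u} [Field K] {R : Type u} [Ring R] [Algebra K R] {e : R} {l : R →ₗ[K] K}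

theorem hasDepthGE_of_span_eq_top (he : Submodule.span R (Set.range fun r : R => e * r) = ⊤)
    (N : Type u) [AddCommGroup N] [Module R N] (n : ℕ) : HasDepthGE e N n := by
  intro X hX i _
  have ker_eq_top : ∀ x : X, LinearMap.ker (LinearMap.toSpanSingleton R X x) = ⊤ := fun x =>
    top_le_iff.1 <| he ▸ Submodule.span_le.2 <| by
      rintro _ ⟨r, rfl⟩
      exact (mul_smul e r x).trans (hX _)
  have : Subsingleton X := subsingleton_of_forall_eq 0 fun x => by
    rw [← LinearMap.toSpanSingleton_apply_one R X x, LinearMap.ker_eq_top.1 (ker_eq_top x),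
      LinearMap.zero_apply]
  rcases i with _ | i
  · exact extVanishesAt_zero_iff.2 fun f => LinearMap.ext fun x => by
      rw [Subsingleton.elim x 0, map_zero, map_zero]
  · have : Module.Projective R X := @Module.Projective.of_free _ _ _ _ _ (.of_subsingleton R X)
    exact extVanishesAt_succ_of_projective i

theorem FaithfulSymmetricCorner.span_eq_top (h : FaithfulSymmetricCorner K R e l)
    [FiniteDimensional K R] (hR : HasDepthGE e R 2) {g : ℕ} (hg : g < 2)
    (hgR : HasInjectiveDimensionLE (ModuleCat.of R R) g) :
    Submodule.span R (Set.range fun r : R => e * r) = ⊤ := by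
  obtain ⟨m, f, hf, hC⟩ := h.exists_cosyzygy hR
  obtain ⟨q, hq⟩ := exists_extension_of_extVanishesAt_one hf (exact_mkQ_range f)
    (Submodule.mkQ_surjective _) (h.extVanishesAt_of_hasDepthGE hgR 1 _ hC 0 hg) LinearMap.id
  have q_surjective : Function.Surjective q := fun r => ⟨f r, LinearMap.congr_fun hq r⟩
  rw [← top_le_iff, ← LinearMap.range_eq_top.2 q_surjective, LinearMap.range_eq_map,
    ← h.span_range_smul_pi_leftIdeal m, Submodule.map_span, Submodule.span_le]
  rintro _ ⟨_, ⟨z, rfl⟩, rfl⟩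
  exact Submodule.subset_span ⟨q z, (map_smul q e z).symm⟩

end SmallInjectiveDimension

section Balance

variable {K : Type u} [Field K] {R S : Type u} [Ring R] [Algebra K R] [Ring S] [Algebra K S]
  [FiniteDimensional K R] [FiniteDimensional K S] {e : R} {e' : S} {l : R →ₗ[K] K}
  {l' : S →ₗ[K] K} {θ : R ≃ₐ[K] Sᵐᵒᵖ}

theorem FaithfulSymmetricCorner.hasDepthGE_and_hasDepthGE_dualMod_of_two_mul_le
    (h : FaithfulSymmetricCorner K R e l) (h' : FaithfulSymmetricCorner K S e' l')
    (he : θ e = op e') (hR : HasDepthGE e R 2) (hS : HasDepthGE e' S 2) {g : ℕ}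
    (hgR : HasInjectiveDimensionLE (ModuleCat.of R R) g)
    (hgS : HasInjectiveDimensionLE (ModuleCat.of S S) g) {a b : ℕ} (hab : 2 * g ≤ a + b)
    {M : Type u} [AddCommGroup M] [Module K M] [Module R M] [IsScalarTower K R M]
    [FiniteDimensional K M] (hM : HasDepthGE e M a) (hDM : HasDepthGE e' (DualMod θ M) b)
    (n : ℕ) : HasDepthGE e M n ∧ HasDepthGE e' (DualMod θ M) n := by
  rcases lt_or_ge g 2 with hg | hg
  · exact ⟨hasDepthGE_of_span_eq_top (h.span_eq_top hR hg hgR) M n,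
      hasDepthGE_of_span_eq_top (h'.span_eq_top hS hg hgS) _ n⟩
  rcases le_total g a with ha | ha
  · exact h.hasDepthGE_and_hasDepthGE_dualMod_of_le_add h' he hR hS hg hgR hgS (a - g) b
      (by omega) M (hM.mono (by omega)) hDM n
  · have he' : antiSymm θ e' = op e := by rw [antiSymm_apply, ← he, AlgEquiv.symm_apply_apply]
    have swapped := h'.hasDepthGE_and_hasDepthGE_dualMod_of_le_add h he' hS hR hg hgS hgR (b - g) a
      (by omega) (DualMod θ M) (hDM.mono (by omega)) (hM.of_linearEquiv (DualMod.evalEquiv θ M)) n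
    exact ⟨swapped.2.of_linearEquiv (DualMod.evalEquiv θ M).symm, swapped.1⟩

end Balance

theorem exists_natCast_le_of_le_add {x y : ℕ∞} {n : ℕ} (h : (n : ℕ∞) ≤ x + y) :
    ∃ a b : ℕ, (a : ℕ∞) ≤ x ∧ (b : ℕ∞) ≤ y ∧ n ≤ a + b := by
  induction x with
  | top => exact ⟨n, 0, le_top, zero_le, n.le_add_right 0⟩
  | coe a =>
    induction y with
    | top => exact ⟨0, n, zero_le, le_top, n.le_add_left 0⟩
    | coe b => exact ⟨a, b, le_rfl, le_rfl, by exact_mod_cast h⟩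

/-! ### Gendo-symmetric algebras -/

section GendoSymmetric

variable {K : Type u} [Field K] {A : Type u} [Ring A] [Algebra K A] {e : A}

/-- The condition on `φ : eA → D(Ae)` in `HasBimoduleIso`: it is a map of `(eAe, A)`-bimodules. -/
def IsBimoduleIso (φ : rightIdeal A e ≃ₗ[K] Module.Dual K (leftIdeal A e)) : Prop :=
  ∀ (b a : A) (y : rightIdeal A e) (z : leftIdeal A e),
    φ (rightIdeal.act b y a) z = φ y (leftIdeal.act a z b)

variable (K e) in
/-- Right multiplication by `e`, as a map `A → Ae`. -/
def mulRightToLeftIdeal : A →ₗ[K] leftIdeal A e :=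
  ((LinearMap.toSpanSingleton A A e).codRestrict (leftIdeal A e) fun a => ⟨a, rfl⟩).restrictScalars
    K

/-- The linear form on `A` representing an isomorphism `φ : eA → D(Ae)`, see
`apply_eq_cornerForm`. -/
def cornerForm (φ : rightIdeal A e ≃ₗ[K] Module.Dual K (leftIdeal A e)) : A →ₗ[K] K :=
  φ ⟨e, 1, (mul_one e).symm⟩ ∘ₗ mulRightToLeftIdeal K e

section CornerForm

variable {φ : rightIdeal A e ≃ₗ[K] Module.Dual K (leftIdeal A e)}

theorem cornerForm_mul_e (he : IsIdempotentElem e) (a : A) :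
    cornerForm φ (a * e) = cornerForm φ a :=
  congrArg (φ ⟨e, 1, (mul_one e).symm⟩) <| Subtype.ext <|
    show a * e * e = a * e by rw [mul_assoc, he.eq]

theorem apply_eq_cornerForm (he : IsIdempotentElem e) (hφ : IsBimoduleIso φ)
    (y : rightIdeal A e) (z : leftIdeal A e) : φ y z = cornerForm φ (y * z) := by
  let e_mem : rightIdeal A e := ⟨e, 1, (mul_one e).symm⟩
  have e_mul : e * (y : A) = y := by
    obtain ⟨_, a, rfl⟩ := y
    rw [← mul_assoc, he.eq]
  have y_eq : rightIdeal.act 1 e_mem (y : A) = y := Subtype.ext <|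
    show e * 1 * e * e * (y : A) = y by rw [mul_one, he.eq, he.eq, e_mul]
  have z_eq : leftIdeal.act (y : A) z 1 = mulRightToLeftIdeal K e (y * z) := Subtype.ext <|
    show (y : A) * z * (e * 1 * e) = y * z * e by rw [mul_one, he.eq]
  calc φ y z = φ (rightIdeal.act 1 e_mem (y : A)) z := by rw [y_eq]
    _ = φ e_mem (leftIdeal.act (y : A) z 1) := hφ _ _ _ _
    _ = cornerForm φ (y * z) := by rw [z_eq]; rfl

theorem cornerForm_e_mul (he : IsIdempotentElem e) (hφ : IsBimoduleIso φ) (a : A) :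
    cornerForm φ (e * a) = cornerForm φ a := by
  have := apply_eq_cornerForm he hφ ⟨e, 1, (mul_one e).symm⟩ (mulRightToLeftIdeal K e a)
  rw [← cornerForm_mul_e he (e * a), mul_assoc]
  exact this.symm

theorem e_mul_eq_zero_of_cornerForm (he : IsIdempotentElem e) (hφ : IsBimoduleIso φ)
    {y : A} (hy : ∀ r, cornerForm φ (y * r) = 0) : e * y = 0 := by
  have y_eq_zero : (⟨e * y, y, rfl⟩ : rightIdeal A e) = 0 :=
    φ.injective <| LinearMap.ext fun z => by
      rw [apply_eq_cornerForm he hφ, mul_assoc, cornerForm_e_mul he hφ, hy, map_zero,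
        LinearMap.zero_apply]
  exact congrArg Subtype.val y_eq_zero

theorem cornerForm_symm (he : IsIdempotentElem e) (hφ : IsBimoduleIso φ) (x y : A) :
    cornerForm φ (x * e * y) = cornerForm φ (y * e * x) := by
  let e_mem : rightIdeal A e := ⟨e, 1, (mul_one e).symm⟩
  have act_right : φ (rightIdeal.act x e_mem 1) (mulRightToLeftIdeal K e y) =
      cornerForm φ (x * e * y) := by
    rw [apply_eq_cornerForm he hφ]
    change cornerForm φ (e * x * e * e * 1 * (y * e)) = _
    rw [mul_one, mul_assoc (e * x), he.eq, ← mul_assoc, cornerForm_mul_e he, mul_assoc e x,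
      mul_assoc e, cornerForm_e_mul he hφ]
  have act_left : leftIdeal.act 1 (mulRightToLeftIdeal K e y) x =
      mulRightToLeftIdeal K e (y * e * x) := Subtype.ext <|
    show 1 * (y * e) * (e * x * e) = y * e * x * e by
      rw [one_mul, ← mul_assoc, ← mul_assoc, mul_assoc y e e, he.eq]
  rw [← act_right, hφ, act_left]
  rfl

end CornerForm

theorem HasBimoduleIso.exists_faithfulSymmetricCorner (hφ : HasBimoduleIso K A e)
    (he : IsIdempotentElem e) (hf : FaithfulSMul Aᵐᵒᵖ (rightIdeal A e)) :
    ∃ l : A →ₗ[K] K, FaithfulSymmetricCorner K A e l := by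
  obtain ⟨φ, hφ⟩ := hφ
  have faithful_left : ∀ a : A, (∀ b, e * b * a = 0) → a = 0 := fun a ha =>
    op_injective <| hf.eq_of_smul_eq_smul (α := rightIdeal A e) fun y => by
      obtain ⟨_, b, rfl⟩ := y
      exact Subtype.ext ((ha b).trans (mul_zero (e * b)).symm)
  refine ⟨cornerForm φ, he, cornerForm_mul_e he, cornerForm_symm he hφ, fun x hx => ?_,
    faithful_left, fun a ha => faithful_left a fun b => ?_⟩
  · rw [mul_assoc]
    refine e_mul_eq_zero_of_cornerForm he hφ fun r => ?_
    rw [cornerForm_symm he hφ, mul_assoc, ← cornerForm_mul_e he, mul_assoc]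
    exact hx r
  · rw [mul_assoc]
    refine e_mul_eq_zero_of_cornerForm he hφ fun r => ?_
    rw [← cornerForm_mul_e he, mul_assoc b, mul_assoc b, ha, mul_zero, map_zero]

namespace FaithfulSymmetricCorner

variable {l : A →ₗ[K] K}

theorem opposite (h : FaithfulSymmetricCorner K A e l) :
    FaithfulSymmetricCorner K Aᵐᵒᵖ (op e) (l ∘ₗ (opLinearEquiv K).symm.toLinearMap) :=
  h.dual (θ := antiSymm AlgEquiv.refl) rfl fun _ => rfl

theorem hasDepthGE_two_of_opposite [FiniteDimensional K A] (h : FaithfulSymmetricCorner K A e l)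
    (hA : HasDepthGE (op e) Aᵐᵒᵖ 2) : HasDepthGE e A 2 :=
  h.hasDepthGE_of_doubleCentralizer <|
    (h.opposite.doubleCentralizer_of_hasDepthGE hA).dual (θ := AlgEquiv.refl) rfl fun _ => rfl

end FaithfulSymmetricCorner

theorem IsGendoSymmetric.exists_corner [FiniteDimensional K A] (hA : IsGendoSymmetric K A) :
    ∃ (e : A) (l : A →ₗ[K] K), FaithfulSymmetricCorner K A e l ∧ HasDepthGE (op e) Aᵐᵒᵖ 2 := by
  obtain ⟨two_le_domdim, e, he, minimal_faithful, -, -, hφ⟩ := hA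
  obtain ⟨l, h⟩ := hφ.exists_faithfulSymmetricCorner he minimal_faithful.1
  have : Module.Finite Aᵐᵒᵖ A := Module.Finite.equiv (opLinearEquiv Aᵐᵒᵖ).symm
  exact ⟨e, l, h, ((h.opposite.le_domdim_iff 2).1 two_le_domdim).of_linearEquiv
    (opLinearEquiv Aᵐᵒᵖ)⟩

section RightModule

variable (M : Type u) [AddCommGroup M] [Module K M] [Module Aᵐᵒᵖ M] [IsScalarTower K Aᵐᵒᵖ M]

variable (K A) in
/-- The duality `D` of right modules is `DualMod` for the tautological identification of `Aᵐᵒᵖ`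
with the opposite algebra of `A`. -/
def dualEquiv : D K M ≃ₗ[A] DualMod (AlgEquiv.refl : Aᵐᵒᵖ ≃ₐ[K] Aᵐᵒᵖ) M where
  toFun f := f.toLin
  invFun f := f.toDual
  map_add' _ _ := rfl
  map_smul' _ _ := rfl
  left_inv _ := rfl
  right_inv _ := rfl

variable {M} [FiniteDimensional K A] [FiniteDimensional K M] {l : A →ₗ[K] K}

theorem FaithfulSymmetricCorner.le_codomdim_iff (h : FaithfulSymmetricCorner K A e l) (n : ℕ) :
    (n : ℕ∞) ≤ codomdim K A M ↔
      HasDepthGE e (DualMod (AlgEquiv.refl : Aᵐᵒᵖ ≃ₐ[K] Aᵐᵒᵖ) M) n := by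
  have : Module.Finite A (DualMod (AlgEquiv.refl : Aᵐᵒᵖ ≃ₐ[K] Aᵐᵒᵖ) M) :=
    Module.Finite.of_restrictScalars_finite K A _
  have : Module.Finite A (D K M) := Module.Finite.equiv (dualEquiv K A M).symm
  exact (h.le_domdim_iff n).trans ⟨fun H => H.of_linearEquiv (dualEquiv K A M),
    fun H => H.of_linearEquiv (dualEquiv K A M).symm⟩

/- A Gorenstein projective module is reflexive, hence of depth at least two; from there on the
depth is controlled by `Ext(DA, M)`, which vanishes with `Ext(DM, A)`. -/
theorem IsGorensteinProjectiveInjective.hasDepthGE (hM : IsGorensteinProjectiveInjective K A M)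
    (h : FaithfulSymmetricCorner K A e l) (hA : HasDepthGE (op e) Aᵐᵒᵖ 2) (n : ℕ) :
    HasDepthGE (op e) M n ∧ HasDepthGE e (DualMod (AlgEquiv.refl : Aᵐᵒᵖ ≃ₐ[K] Aᵐᵒᵖ) M) n := by
  let θ : Aᵐᵒᵖ ≃ₐ[K] Aᵐᵒᵖ := AlgEquiv.refl
  obtain ⟨projective, injective⟩ := hM
  have hA' := h.hasDepthGE_two_of_opposite hA
  have : Module.Projective Aᵐᵒᵖ A := Module.Projective.of_equiv (opLinearEquiv Aᵐᵒᵖ).symm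
  have : Module.Finite Aᵐᵒᵖ M := Module.Finite.of_restrictScalars_finite K _ _
  have : Module.Finite A (DualMod θ M) := Module.Finite.of_restrictScalars_finite K _ _
  have depth_two : HasDepthGE (op e) M 2 := .two_of_bijective_eval
    (hA.of_linearEquiv (opLinearEquiv Aᵐᵒᵖ).symm)
    (projective.bijective_eval (RingEquiv.moduleEndSelf A).bijective)
  have dual_depth_two : HasDepthGE e (D K M) 2 := .two_of_bijective_eval hA'
    (injective.bijective_eval (RingEquiv.moduleEndSelfOp A).bijective)
  constructor
  · refine h.opposite.hasDepthGE_of_extVanishesAt hA (θ := θ) rfl hA'.torsionFree depth_two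
      (fun i => ?_) n
    exact (DualMod.extVanishesAt_succ_dual (antiSymm θ) i _
      ((extVanishes_iff_forall_succ.1 injective.1 i).of_linearEquiv (dualEquiv K A M)
        (.refl A A))).of_linearEquiv (.refl _ _) (DualMod.evalEquiv θ M).symm
  · refine h.hasDepthGE_of_extVanishesAt hA' (θ := antiSymm θ) rfl hA.torsionFree
      (dual_depth_two.of_linearEquiv (dualEquiv K A M)) (fun i => ?_) n
    exact DualMod.extVanishesAt_succ_dual θ i _
      ((extVanishes_iff_forall_succ.1 projective.1 i).of_linearEquiv (.refl _ _)
        (opLinearEquiv Aᵐᵒᵖ))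

theorem FaithfulSymmetricCorner.isGorensteinProjectiveInjective
    (h : FaithfulSymmetricCorner K A e l) {g : ℕ}
    (hr : HasInjectiveDimensionLE (ModuleCat.of Aᵐᵒᵖ A) g)
    (hl : HasInjectiveDimensionLE (ModuleCat.of A A) g) (hM : HasDepthGE (op e) M g)
    (hDM : HasDepthGE e (DualMod (AlgEquiv.refl : Aᵐᵒᵖ ≃ₐ[K] Aᵐᵒᵖ) M) g) :
    IsGorensteinProjectiveInjective K A M := by
  have : Module.Projective Aᵐᵒᵖ A := Module.Projective.of_equiv (opLinearEquiv Aᵐᵒᵖ).symm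
  have : Module.Finite Aᵐᵒᵖ M := Module.Finite.of_restrictScalars_finite K _ _
  have : Module.Finite A (DualMod (AlgEquiv.refl : Aᵐᵒᵖ ≃ₐ[K] Aᵐᵒᵖ) M) :=
    Module.Finite.of_restrictScalars_finite K _ _
  have : Module.Finite A (D K M) := Module.Finite.equiv (dualEquiv K A M).symm
  have := IsNoetherianRing.of_finite K A
  have := IsNoetherianRing.of_finite K Aᵐᵒᵖ
  obtain ⟨p⟩ := exists_minProjPresentation K M (R := Aᵐᵒᵖ)
  obtain ⟨q⟩ := exists_minProjPresentation K (D K M) (R := A)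
  exact ⟨isGProj_of_extVanishesAt hl
      (fun i => h.opposite.extVanishesAt_of_hasDepthGE hr g M hM i (by omega)) p,
    isGProj_of_extVanishesAt hr (fun i => h.extVanishesAt_of_hasDepthGE hl g (D K M)
      (hDM.of_linearEquiv (dualEquiv K A M).symm) i (by omega)) q⟩

end RightModule

end GendoSymmetric

end GendoSymm

theorem mainTheorem12_general (K : Type u) [Field K] (A : Type u) [Ring A] [Algebra K A]
    [FiniteDimensional K A] (hA : GendoSymm.IsGendoSymmetric K A) (g : ℕ)
    (hr : CategoryTheory.injectiveDimension (ModuleCat.of Aᵐᵒᵖ A) ≤ g)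
    (hl : CategoryTheory.injectiveDimension (ModuleCat.of A A) ≤ g)
    (M : Type u) [AddCommGroup M] [Module K M] [Module Aᵐᵒᵖ M] [IsScalarTower K Aᵐᵒᵖ M]
    [FiniteDimensional K M] :
    List.TFAE
      [GendoSymm.IsGorensteinProjectiveInjective K A M,
        ((2 * g : ℕ) : ℕ∞) ≤ GendoSymm.domdim Aᵐᵒᵖ M + GendoSymm.codomdim K A M,
        ((2 * g : ℕ) : ℕ∞) ≤ GendoSymm.domdim Aᵐᵒᵖ M,
        ((2 * g : ℕ) : ℕ∞) ≤ GendoSymm.codomdim K A M] := by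
  obtain ⟨e, l, h, depth_right⟩ := hA.exists_corner
  have depth_left := h.hasDepthGE_two_of_opposite depth_right
  have hgr := (CategoryTheory.injectiveDimension_le_iff _ g).1 hr
  have hgl := (CategoryTheory.injectiveDimension_le_iff _ g).1 hl
  have hgr' := CategoryTheory.hasInjectiveDimensionLT_of_iso
    (MulOpposite.opLinearEquiv Aᵐᵒᵖ : A ≃ₗ[Aᵐᵒᵖ] Aᵐᵒᵖ).toModuleIso (g + 1)
  have : Module.Finite Aᵐᵒᵖ M := Module.Finite.of_restrictScalars_finite K _ _
  tfae_have 1 → 3 := fun H => (h.opposite.le_domdim_iff _).2 (H.hasDepthGE h depth_right _).1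
  tfae_have 1 → 4 := fun H => (h.le_codomdim_iff _).2 (H.hasDepthGE h depth_right _).2
  tfae_have 3 → 2 := fun H => H.trans le_self_add
  tfae_have 4 → 2 := fun H => H.trans le_add_self
  tfae_have 2 → 1 := fun H => by
    obtain ⟨a, b, ha, hb, hab⟩ := GendoSymm.exists_natCast_le_of_le_add H
    obtain ⟨depth, dual_depth⟩ := h.opposite.hasDepthGE_and_hasDepthGE_dualMod_of_two_mul_le h rfl
      depth_right depth_left hgr' hgl hab ((h.opposite.le_domdim_iff a).1 ha)
      ((h.le_codomdim_iff b).1 hb) g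
    exact h.isGorensteinProjectiveInjective hgr hgl depth dual_depth
  tfae_finish

theorem mainTheorem12 (K : Type u) [Field K] (A : Type u) [Ring A] [Algebra K A]
    [FiniteDimensional K A]
    (hA : GendoSymm.IsGendoSymmetric K A) (hns : ¬ GendoSymm.IsSelfinjective A)
    (g : ℕ) (hg : GendoSymm.IsGorensteinOfDim A g)
    (M : Type u) [AddCommGroup M] [Module K M] [Module Aᵐᵒᵖ M] [IsScalarTower K Aᵐᵒᵖ M]
    [FiniteDimensional K M] :
    List.TFAE
      [GendoSymm.IsGorensteinProjectiveInjective K A M,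
        ((2 * g : ℕ) : ℕ∞) ≤ GendoSymm.domdim Aᵐᵒᵖ M + GendoSymm.codomdim K A M,
        ((2 * g : ℕ) : ℕ∞) ≤ GendoSymm.domdim Aᵐᵒᵖ M,
        ((2 * g : ℕ) : ℕ∞) ≤ GendoSymm.codomdim K A M] :=
  mainTheorem12_general K A hA g hg.right.le hg.left.le M
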